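/- Let $R$ be a commutative ring, let $n\ge 1$ and $k\ge 1$ be integers, let $f_1,\dots,f_n\in R$, and let $J=(f_1,\dots,f_n)$. For an ideal $I$ of $R$ write $\overline{I}$ for its integral closure, that is, the ideal of all $x\in R$ satisfying an equation $x^d+a_1x^{d-1}+\dots+a_d=0$ with $a_i\in I^i$. Let $\pi\colon Y\to\operatorname{Spec}R$ be the blowup $\operatorname{Proj}\bigoplus_{i\ge 0}\overline{J^{n+k-1}}^{\,i}$ of $\overline{J^{n+k-1}}$, or, more generally, any morphism of schemes that dominates it, i.e. that factors through this blowup over $\operatorname{Spec}R$. Then the natural map $$\overline{J^{n+k-1}}\;\hookrightarrow\; R\;\longrightarrow\; H_0\big(L^k(\underline f)\otimes^{\mathbb L}_R \mathbb R\Gamma(Y,\mathcal O_Y)\big)$$ is zero. Here $L^k(\underline f)$ is the Buchsbaum–Eisenbud complex $$0\to L^k_n(F)\to L^k_{n-1}(F)\to\dots\to L^k_1(F)\to R\to 0$$ associated to $(f_1,\dots,f_n)^k$, with $R$ in degree $0$: $F$ is the free $R$-module with basis $e_1,\dots,e_n$, and $S_m F$ is its $m$-th symmetric power; for $i\ge 1$,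 $L^k_i(F)$ is the image of the Koszul map $\bigwedge^iF\otimes_R S_{k-1}F\to\bigwedge^{i-1}F\otimes_R S_kF$; the map $L^k_{i+1}(F)\to L^k_i(F)$ for $i\ge1$ is induced by contraction of the exterior factor with the linear form $F\to R$, $e_j\mapsto f_j$; and $L^k_1(F)=S_kF\to R$ is evaluation at $e_j\mapsto f_j$. The map $R\to H_0(L^k(\underline f)\otimes^{\mathbb L}_R\mathbb R\Gamma(Y,\mathcal O_Y))$ is induced by the inclusion $R=L_0\to L^k(\underline f)$ and by the canonical map $R\to\mathbb R\Gamma(Y,\mathcal O_Y)$. -/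

import Mathlib

universe u

namespace BrianconSkoda

section IntegralClosure

open Polynomial

/-- The element `x` satisfies an equation of integral dependence
`x ^ d + a₁ x ^ (d - 1) + ⋯ + a_d = 0` over the ideal `I`, with `a_i ∈ I ^ i`. -/
def IsIntegralOverIdeal {R : Type u} [CommRing R] (I : Ideal R) (x : R) : Prop :=
  ∃ (d : ℕ) (a : ℕ → R), (∀ i ∈ Finset.Icc 1 d, a i ∈ I ^ i) ∧
    x ^ d + ∑ i ∈ Finset.Icc 1 d, a i * x ^ (d - i) = 0

/-- `x` is integral over `I` iff `x t` is integral over the Rees algebra `R[It]` in `R[t]`. -/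
theorem isIntegralOverIdeal_iff {R : Type u} [CommRing R] (I : Ideal R) (x : R) :
    IsIntegralOverIdeal I x ↔ IsIntegral (reesAlgebra I) (monomial 1 x : R[X]) := by
  constructor
  · rintro ⟨d, a, ha, h⟩
    let c : ℕ → reesAlgebra I := fun i =>
      if hi : i ∈ Finset.Icc 1 d then ⟨monomial i (a i), reesAlgebra.monomial_mem.2 (ha i hi)⟩ else 0
    refine ⟨X ^ d + ∑ i ∈ Finset.Icc 1 d, C (c i) * X ^ (d - i), ?_, ?_⟩
    · nontriviality (reesAlgebra I)
      refine monic_X_pow_add ?_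
      refine lt_of_le_of_lt (degree_sum_le _ _) ((Finset.sup_lt_iff (WithBot.bot_lt_coe d)).2 ?_)
      intro i hi
      rw [Finset.mem_Icc] at hi
      refine lt_of_le_of_lt (degree_C_mul_X_pow_le _ _) ?_
      exact WithBot.coe_lt_coe.2 (by simp only [Nat.cast_id]; omega)
    · rw [eval₂_add, eval₂_pow, eval₂_X, eval₂_finsetSum]
      have h2 : ∀ i ∈ Finset.Icc 1 d, eval₂ (algebraMap (reesAlgebra I) R[X]) (monomial 1 x)
          (C (c i) * X ^ (d - i)) = monomial d (a i * x ^ (d - i)) := by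
        intro i hi
        have hc : (algebraMap (reesAlgebra I) R[X]) (c i) = monomial i (a i) := by
          simp only [c, dif_pos hi]; rfl
        rw [eval₂_mul, eval₂_C, eval₂_pow, eval₂_X, hc, monomial_pow, monomial_mul_monomial]
        rw [Finset.mem_Icc] at hi
        rw [one_mul, Nat.add_sub_cancel' hi.2]
      rw [Finset.sum_congr rfl h2, ← map_sum, monomial_pow, one_mul, ← map_add, h, map_zero]
  · rintro ⟨p, hp, h⟩
    refine ⟨p.natDegree, fun i => ((p.coeff (p.natDegree - i) : reesAlgebra I) : R[X]).coeff i,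
      fun i _ => (p.coeff (p.natDegree - i)).2 i, ?_⟩
    have h1 := congrArg (fun q : R[X] => q.coeff p.natDegree) h
    simp only [eval₂_eq_sum_range, finsetSum_coeff, coeff_zero] at h1
    rw [Finset.sum_range_succ] at h1
    have h3 : ∀ (q : R[X]) (j : ℕ), j ≤ p.natDegree →
        (q * monomial 1 x ^ j).coeff p.natDegree = q.coeff (p.natDegree - j) * x ^ j := by
      intro q j hj
      rw [monomial_pow, one_mul, ← C_mul_X_pow_eq_monomial, ← mul_assoc, coeff_mul_X_pow', if_pos hj,
        coeff_mul_C]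
    rw [h3 _ _ le_rfl, hp.coeff_natDegree] at h1
    rw [Finset.sum_congr rfl (fun j hj => h3 _ _ (Finset.mem_range.1 hj).le)] at h1
    rw [← h1, add_comm]
    congr 1
    · refine Finset.sum_bij' (fun i _ => p.natDegree - i) (fun j _ => p.natDegree - j) ?_ ?_ ?_ ?_ ?_
      · intro i hi; simp at hi ⊢; omega
      · intro i hi; simp at hi ⊢; omega
      · intro i hi; simp at hi ⊢; omega
      · intro i hi; simp at hi ⊢; omega
      · intro i hi
        simp only [Finset.mem_Icc] at hi
        rw [show p.natDegree - (p.natDegree - i) = i by omega]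
        rfl
    · simp

/-- The integral closure of an ideal `I`. -/
def idealIntegralClosure {R : Type u} [CommRing R] (I : Ideal R) : Ideal R where
  carrier := {x | IsIntegralOverIdeal I x}
  add_mem' {x y} hx hy := by
    rw [Set.mem_ofPred_eq, isIntegralOverIdeal_iff] at *
    rw [map_add]
    exact hx.add hy
  zero_mem' := by
    rw [Set.mem_ofPred_eq, isIntegralOverIdeal_iff, map_zero]
    exact isIntegral_zero
  smul_mem' r x hx := by
    rw [Set.mem_ofPred_eq, isIntegralOverIdeal_iff] at *
    have h : (monomial 1 (r • x) : R[X]) = algebraMap (reesAlgebra I) R[X] (algebraMap R _ r) * monomial 1 x := by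
      rw [← IsScalarTower.algebraMap_apply, ← Algebra.smul_def, map_smul]
    rw [h]
    exact isIntegral_algebraMap.mul hx

/-- The degree `i` part `Iⁱ tⁱ` of the Rees algebra `R[It]`. -/
noncomputable def reesGrading {R : Type u} [CommRing R] (I : Ideal R) (i : ℕ) : Submodule R (reesAlgebra I) :=
  (LinearMap.range (monomial i : R →ₗ[R] R[X])).comap (reesAlgebra I).val.toLinearMap

theorem reesGrading_isInternal {R : Type u} [CommRing R] (I : Ideal R) :
    DirectSum.IsInternal (reesGrading I) := by
  classical
  constructor
  · intro x x' hx
    ext i : 1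
    apply Subtype.ext
    apply Subtype.ext
    have key : ∀ y : DirectSum ℕ (fun i => reesGrading I i),
        ((((y i : reesGrading I i) : reesAlgebra I)) : R[X]) =
          monomial i (((DirectSum.coeAddMonoidHom (reesGrading I) y : reesAlgebra I) : R[X]).coeff i) := by
      intro y
      induction y using DirectSum.induction_on with
      | zero => simp
      | of j z =>
        rw [DirectSum.coeAddMonoidHom_of]
        obtain ⟨r, hr⟩ := z.2
        have hr' : (((z : reesAlgebra I)) : R[X]) = monomial j r := hr.symm
        by_cases hij : j = i
        · subst hij
          rw [DirectSum.of_eq_same, hr', coeff_monomial_same]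
        · rw [DirectSum.of_eq_of_ne _ _ _ (Ne.symm hij), hr', coeff_monomial_of_ne _ (Ne.symm hij)]
          simp
      | add y z hy hz =>
        rw [DirectSum.add_apply, map_add]
        push_cast
        rw [hy, hz, coeff_add, map_add]
    rw [key x, hx, ← key x']
  · intro p
    refine ⟨∑ i ∈ (p : R[X]).support, DirectSum.of (fun i => reesGrading I i) i
      ⟨⟨monomial i ((p : R[X]).coeff i), reesAlgebra.monomial_mem.2 (p.2 i)⟩, ⟨_, rfl⟩⟩, ?_⟩
    rw [map_sum]
    apply Subtype.ext
    simp only [DirectSum.coeAddMonoidHom_of]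
    rw [AddSubmonoidClass.coe_finsetSum]
    exact (as_sum_support (p : R[X])).symm

noncomputable instance reesGrading.gradedAlgebra {R : Type u} [CommRing R] (I : Ideal R) :
    GradedAlgebra (reesGrading I) where
  one_mem := ⟨1, rfl⟩
  mul_mem := by
    rintro i j x y ⟨a, ha⟩ ⟨b, hb⟩
    refine ⟨a * b, ?_⟩
    rw [← Polynomial.monomial_mul_monomial, ha, hb]
    rfl
  toDecomposition := (reesGrading_isInternal I).chooseDecomposition

end IntegralClosure

section Blowup

open AlgebraicGeometry CategoryTheory

/-- The blowup of `Spec R` along `I`, i.e. `Proj` of the Rees algebra `R[It] = ⨁ Iⁱ tⁱ`. -/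
noncomputable def blowup {R : Type u} [CommRing R] (I : Ideal R) : Scheme.{u} := Proj (reesGrading I)

/-- The structure morphism of the blowup. -/
noncomputable def blowupMap {R : Type u} [CommRing R] (I : Ideal R) :
    blowup I ⟶ Spec (CommRingCat.of R) :=
  Proj.toSpecZero (reesGrading I) ≫
    Spec.map (CommRingCat.ofHom (algebraMap R (reesGrading I 0)))

end Blowup

section Complex

open CategoryTheory TensorProduct

/-- `⋀ F ⊗ S(F)` for the free module `F = Rⁿ`, where the symmetric algebra `S(F)` is the polynomial
ring in the variables `X j` corresponding to the basis vectors `e_j` of `F`. -/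
abbrev ExtSym (R : Type u) [CommRing R] (n : ℕ) : Type u :=
  ExteriorAlgebra R (Fin n → R) ⊗[R] MvPolynomial (Fin n) R

/-- Contraction of the exterior algebra with a linear form `d`, i.e. the antiderivation extending `d`. -/
def contraction {R : Type u} [CommRing R] {n : ℕ} (d : Module.Dual R (Fin n → R)) :
    ExteriorAlgebra R (Fin n → R) →ₗ[R] ExteriorAlgebra R (Fin n → R) :=
  CliffordAlgebra.contractLeft (Q := 0) d

/-- The Koszul map `⋀ⁱ F ⊗ S_m F → ⋀ⁱ⁻¹ F ⊗ S_{m+1} F`, which sends `e_{j₁} ∧ ⋯ ∧ e_{jᵢ} ⊗ s` to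
`∑ₗ (-1)ˡ⁻¹ e_{j₁} ∧ ⋯ ê_{jₗ} ⋯ ∧ e_{jᵢ} ⊗ X_{jₗ} s`, on all degrees at once. -/
noncomputable def koszulMap (R : Type u) [CommRing R] (n : ℕ) : ExtSym R n →ₗ[R] ExtSym R n :=
  ∑ j : Fin n, TensorProduct.map (contraction (LinearMap.proj j)) (LinearMap.mulLeft R (MvPolynomial.X j))

/-- Contraction of the exterior factor with the linear form `F → R`, `e_j ↦ f j`. -/
noncomputable def contractionMap {R : Type u} [CommRing R] {n : ℕ} (f : Fin n → R) :
    ExtSym R n →ₗ[R] ExtSym R n :=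
  TensorProduct.map (contraction (Fintype.linearCombination R f)) LinearMap.id

/-- The map `⋀ F ⊗ S(F) → R` which is zero on `⋀ⁱ F ⊗ S(F)` for `i > 0` and is the evaluation
`X j ↦ f j` on `⋀⁰ F ⊗ S(F) = S(F)`. -/
noncomputable def evalMap {R : Type u} [CommRing R] {n : ℕ} (f : Fin n → R) : ExtSym R n →ₗ[R] R :=
  LinearMap.mul' R R ∘ₗ TensorProduct.map (ExteriorAlgebra.algebraMapInv (R := R)).toLinearMap
      (MvPolynomial.aeval f).toLinearMap

/-- The submodule `⋀ⁱ F ⊗ S_k F` of `⋀ F ⊗ S(F)` (a direct summand, as `F` is free). -/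
noncomputable def bigradedPiece (R : Type u) [CommRing R] (n i k : ℕ) : Submodule R (ExtSym R n) :=
  LinearMap.range (TensorProduct.map (⋀[R]^i (Fin n → R)).subtype
    (MvPolynomial.homogeneousSubmodule (Fin n) R k).subtype)

/-- `L_i^k(F)`, for `i, k ≥ 1`: the image of `⋀ⁱ F ⊗ S_{k-1} F → ⋀ⁱ⁻¹ F ⊗ S_k F`. It vanishes for
`i > n`. -/
noncomputable def beTerm (R : Type u) [CommRing R] (n k i : ℕ) : Submodule R (ExtSym R n) :=
  (bigradedPiece R n i (k - 1)).map (koszulMap R n)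

theorem contraction_mem {R : Type u} [CommRing R] {n : ℕ} (d : Module.Dual R (Fin n → R)) (i : ℕ) :
    ∀ x ∈ ⋀[R]^(i + 1) (Fin n → R), contraction d x ∈ ⋀[R]^i (Fin n → R) := by
  induction i with
  | zero =>
    intro x hx
    rw [zero_add] at hx
    change x ∈ LinearMap.range (ExteriorAlgebra.ι R) ^ 1 at hx
    rw [pow_one] at hx
    obtain ⟨v, rfl⟩ := hx
    change CliffordAlgebra.contractLeft d (CliffordAlgebra.ι 0 v) ∈
      LinearMap.range (ExteriorAlgebra.ι R) ^ 0
    rw [pow_zero, CliffordAlgebra.contractLeft_ι]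
    exact Submodule.algebraMap_mem _
  | succ i ih =>
    intro x hx
    change x ∈ LinearMap.range (ExteriorAlgebra.ι R) ^ (i + 1 + 1) at hx
    rw [pow_succ'] at hx
    induction hx using Submodule.mul_induction_on' with
    | mem_mul_mem a ha b hb =>
      obtain ⟨v, rfl⟩ := ha
      change CliffordAlgebra.contractLeft d (CliffordAlgebra.ι 0 v * b) ∈
        LinearMap.range (ExteriorAlgebra.ι R) ^ (i + 1)
      rw [CliffordAlgebra.contractLeft_ι_mul]
      refine Submodule.sub_mem _ (Submodule.smul_mem _ _ hb) ?_
      rw [pow_succ' (LinearMap.range (ExteriorAlgebra.ι R (M := Fin n → R))) i]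
      exact Submodule.mul_mem_mul ⟨v, rfl⟩ (ih b hb)
    | add a _ b _ ha hb => rw [map_add]; exact Submodule.add_mem _ ha hb

theorem contractionMap_mem_bigradedPiece {R : Type u} [CommRing R] {n : ℕ} (f : Fin n → R) (i k : ℕ) :
    ∀ x ∈ bigradedPiece R n (i + 1) k, contractionMap f x ∈ bigradedPiece R n i k := by
  rintro _ ⟨t, rfl⟩
  induction t using TensorProduct.induction_on with
  | zero => simp
  | tmul a b =>
    exact ⟨⟨_, contraction_mem (Fintype.linearCombination R f) i a a.2⟩ ⊗ₜ b, rfl⟩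
  | add a b ha hb => rw [map_add, map_add]; exact Submodule.add_mem _ ha hb

theorem contractionMap_koszulMap {R : Type u} [CommRing R] {n : ℕ} (f : Fin n → R) (x : ExtSym R n) :
    contractionMap f (koszulMap R n x) = - koszulMap R n (contractionMap f x) := by
  induction x using TensorProduct.induction_on with
  | zero => simp
  | tmul a b =>
    simp only [koszulMap, contractionMap, LinearMap.sum_apply, TensorProduct.map_tmul, map_sum,
      LinearMap.id_coe, id_eq, contraction]
    rw [← Finset.sum_neg_distrib]
    refine Finset.sum_congr rfl fun j _ => ?_
    rw [CliffordAlgebra.contractLeft_comm, TensorProduct.neg_tmul]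
  | add a b ha hb => simp only [map_add, ha, hb, neg_add]

theorem contractionMap_contractionMap {R : Type u} [CommRing R] {n : ℕ} (f : Fin n → R) (x : ExtSym R n) :
    contractionMap f (contractionMap f x) = 0 := by
  induction x using TensorProduct.induction_on with
  | zero => simp
  | tmul a b =>
    simp only [contractionMap, TensorProduct.map_tmul, contraction, CliffordAlgebra.contractLeft_contractLeft,
      TensorProduct.zero_tmul]
  | add a b ha hb => simp only [map_add, ha, hb, add_zero]

theorem evalMap_koszulMap {R : Type u} [CommRing R] {n : ℕ} (f : Fin n → R) (x : ExtSym R n) :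
    evalMap f (koszulMap R n x) = evalMap f (contractionMap f x) := by
  induction x using TensorProduct.induction_on with
  | zero => simp
  | tmul a b =>
    have h : Fintype.linearCombination R f =
        ∑ j, f j • (LinearMap.proj j : Module.Dual R (Fin n → R)) := by
      ext; simp [Fintype.linearCombination_apply, mul_comm]
    simp only [koszulMap, contractionMap, LinearMap.sum_apply, TensorProduct.map_tmul, map_sum,
      LinearMap.id_coe, id_eq, contraction, evalMap, LinearMap.comp_apply, h, map_smul,
      LinearMap.smul_apply, AlgHom.toLinearMap_apply, LinearMap.mul'_apply,
      LinearMap.mulLeft_apply, map_mul, MvPolynomial.aeval_X, Finset.sum_mul, smul_eq_mul]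
    refine Finset.sum_congr rfl fun j _ => by ring
  | add a b ha hb => simp only [map_add, ha, hb]

theorem contractionMap_mem_beTerm {R : Type u} [CommRing R] {n : ℕ} (f : Fin n → R) (k i : ℕ) :
    ∀ x ∈ beTerm R n k (i + 1), contractionMap f x ∈ beTerm R n k i := by
  rintro _ ⟨y, hy, rfl⟩
  rw [contractionMap_koszulMap]
  exact Submodule.neg_mem _ ⟨_, contractionMap_mem_bigradedPiece f i _ y hy, rfl⟩

/-- The differential `L_{i+1}^k(F) → L_i^k(F)` for `i ≥ 1`, induced by
`⋀ⁱ F ⊗ S_k F → ⋀ⁱ⁻¹ F ⊗ S_k F`. -/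
noncomputable def beDiff {R : Type u} [CommRing R] {n : ℕ} (f : Fin n → R) (k i : ℕ) :
    beTerm R n k (i + 1) →ₗ[R] beTerm R n k i :=
  (contractionMap f).restrict (contractionMap_mem_beTerm f k i)

/-- The differential `L_1^k(F) = S_k F → R`, a monomial in the `X j` going to the same monomial in the
`f j`. -/
noncomputable def beAugmentation {R : Type u} [CommRing R] {n : ℕ} (f : Fin n → R) (k : ℕ) :
    beTerm R n k 1 →ₗ[R] R :=
  evalMap f ∘ₗ (beTerm R n k 1).subtype

theorem beDiff_beDiff {R : Type u} [CommRing R] {n : ℕ} (f : Fin n → R) (k i : ℕ) :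
    beDiff f k i ∘ₗ beDiff f k (i + 1) = 0 :=
  LinearMap.ext fun x => Subtype.ext (contractionMap_contractionMap f x.1)

theorem beAugmentation_beDiff {R : Type u} [CommRing R] {n : ℕ} (f : Fin n → R) (k : ℕ) :
    beAugmentation f k ∘ₗ beDiff f k 1 = 0 := by
  ext ⟨_, y, _, rfl⟩
  change evalMap f (contractionMap f (koszulMap R n y)) = 0
  rw [contractionMap_koszulMap, map_neg, evalMap_koszulMap, contractionMap_contractionMap, map_zero, neg_zero]

/-- The Buchsbaum–Eisenbud complex `⋯ → L_2^k(F) → L_1^k(F) → R → 0` attached to `(f₁, …, fₙ)ᵏ`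
(for `k ≥ 1`), with `R` in degree `0`. -/
noncomputable def beChainComplex {R : Type u} [CommRing R] {n : ℕ} (f : Fin n → R) (k : ℕ) :
    ChainComplex (ModuleCat.{u} R) ℕ :=
  ChainComplex.augment (X := ModuleCat.of R R)
    (ChainComplex.of (fun i => ModuleCat.of R (beTerm R n k (i + 1)))
      (fun i => ModuleCat.ofHom (beDiff f k (i + 1)))
      (fun i => by rw [← ModuleCat.ofHom_comp, beDiff_beDiff]; rfl))
    (ModuleCat.ofHom (beAugmentation f k))
    (by
      have h : (ChainComplex.of (fun i => ModuleCat.of R (beTerm R n k (i + 1)))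
          (fun i => ModuleCat.ofHom (beDiff f k (i + 1)))
          (fun i => by rw [← ModuleCat.ofHom_comp, beDiff_beDiff]; rfl)).d 1 0 =
          ModuleCat.ofHom (beDiff f k 1) :=
        ChainComplex.of_d (fun i => ModuleCat.of R (beTerm R n k (i + 1)))
          (fun i => ModuleCat.ofHom (beDiff f k (i + 1))) (j := 0)
      rw [h, ← ModuleCat.ofHom_comp, beAugmentation_beDiff]; rfl)

/-- The Buchsbaum–Eisenbud complex as a cochain complex: `L_i` sits in cohomological degree `-i`. -/
noncomputable def buchsbaumEisenbud {R : Type u} [CommRing R] {n : ℕ} (f : Fin n → R) (k : ℕ) :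
    CochainComplex (ModuleCat.{u} R) ℤ :=
  (beChainComplex f k).extend ComplexShape.embeddingDownNat

/-- The inclusion of `R = L_0` (a complex in degree `0`) in the Buchsbaum–Eisenbud complex. -/
noncomputable def buchsbaumEisenbudUnit {R : Type u} [CommRing R] {n : ℕ} (f : Fin n → R) (k : ℕ) :
    HomologicalComplex.tensorUnit (ModuleCat.{u} R) (ComplexShape.up ℤ) ⟶ buchsbaumEisenbud f k :=
  HomologicalComplex.mkHomFromSingle
    (((beChainComplex f k).extendXIso ComplexShape.embeddingDownNat (i := 0) (i' := 0) rfl).inv)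
    (fun j hj => by
      have : Limits.IsZero ((buchsbaumEisenbud f k).X j) := by
        refine HomologicalComplex.isZero_extend_X _ _ _ fun i hi => ?_
        simp at hi hj
        omega
      exact this.eq_of_tgt _ _)

end Complex

section StructureSheaf

open AlgebraicGeometry CategoryTheory Opposite TopologicalSpace

/-- For a scheme `π : Y ⟶ Spec R`, the ring map `R → Γ(Y, U)`. -/
noncomputable def algebraToSections {R : Type u} [CommRing R] {Y : Scheme.{u}} (π : Y ⟶ Spec (CommRingCat.of R))
    (U : Y.Opens) : R →+* Γ(Y, U) :=
  ((Scheme.ΓSpecIso (CommRingCat.of R)).inv ≫ π.appTop ≫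
    Y.presheaf.map (homOfLE (le_top : U ≤ ⊤)).op).hom

/-- `Γ(Y, U)` as an `R`-module. -/
noncomputable abbrev sectionsModule {R : Type u} [CommRing R] {Y : Scheme.{u}} (π : Y ⟶ Spec (CommRingCat.of R))
    (U : Y.Opens) : Module R Γ(Y, U) :=
  Module.compHom _ (algebraToSections π U)

theorem map_algebraToSections {R : Type u} [CommRing R] {Y : Scheme.{u}} (π : Y ⟶ Spec (CommRingCat.of R))
    {U V : Y.Opens} (i : U ⟶ V) (r : R) :
    (Y.presheaf.map i.op).hom (algebraToSections π V r) = algebraToSections π U r := by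
  unfold algebraToSections
  rw [← CommRingCat.comp_apply, Category.assoc, Category.assoc, ← Functor.map_comp]
  rfl

/-- `Γ(Y, U)` as an object of the category of `R`-modules. -/
noncomputable def sectionsObj {R : Type u} [CommRing R] {Y : Scheme.{u}} (π : Y ⟶ Spec (CommRingCat.of R))
    (U : Y.Opens) : ModuleCat.{u} R :=
  letI := sectionsModule π U
  ModuleCat.of R Γ(Y, U)

/-- The restriction map `Γ(Y, V) → Γ(Y, U)`, as an `R`-linear map. -/
noncomputable def sectionsRestrict {R : Type u} [CommRing R] {Y : Scheme.{u}} (π : Y ⟶ Spec (CommRingCat.of R))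
    {U V : Y.Opens} (i : U ⟶ V) : sectionsObj π V ⟶ sectionsObj π U :=
  letI := sectionsModule π U
  letI := sectionsModule π V
  ModuleCat.ofHom
    { toFun := (Y.presheaf.map i.op).hom
      map_add' := map_add _
      map_smul' := fun r s =>
        (map_mul (Y.presheaf.map i.op).hom (algebraToSections π V r) s).trans
          (congrArg (· * _) (map_algebraToSections π i r)) }

/-- The structure sheaf `𝒪_Y`, as a presheaf of `R`-modules. -/
noncomputable def structurePresheaf {R : Type u} [CommRing R] {Y : Scheme.{u}} (π : Y ⟶ Spec (CommRingCat.of R)) :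
    TopCat.Presheaf (ModuleCat.{u} R) Y where
  obj U := sectionsObj π U.unop
  map i := sectionsRestrict π i.unop
  map_id U := by
    ext x
    exact congrArg (fun g => g.hom x) (Y.presheaf.map_id U)
  map_comp i j := by
    ext x
    exact congrArg (fun g => g.hom x) (Y.presheaf.map_comp i j)

/-- The structure sheaf `𝒪_Y`, as a sheaf of `R`-modules on `Y`. -/
noncomputable def structureSheaf {R : Type u} [CommRing R] {Y : Scheme.{u}} (π : Y ⟶ Spec (CommRingCat.of R)) :
    TopCat.Sheaf (ModuleCat.{u} R) Y :=
  ⟨structurePresheaf π, (TopCat.Presheaf.isSheaf_iff_isSheaf_comp (forget (ModuleCat.{u} R)) _).2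
    ((TopCat.Presheaf.isSheaf_iff_isSheaf_comp (forget CommRingCat.{u}) _).1 Y.sheaf.2)⟩

/-- The global sections functor on sheaves of `R`-modules on `Y`. -/
noncomputable def globalSections (R : Type u) [CommRing R] (Y : Scheme.{u}) : TopCat.Sheaf (ModuleCat.{u} R) Y ⥤ ModuleCat.{u} R :=
  sheafToPresheaf _ _ ⋙ (evaluation _ _).obj (op ⊤)

instance globalSections.additive (R : Type u) [CommRing R] (Y : Scheme.{u}) :
    (globalSections R Y).Additive where
  map_add := rfl

/-- `RΓ(Y, F)`, computed by an injective resolution of `F`. -/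
noncomputable def derivedSections {R : Type u} [CommRing R] {Y : Scheme.{u}} {F : TopCat.Sheaf (ModuleCat.{u} R) Y}
    (I : InjectiveResolution F) : CochainComplex (ModuleCat.{u} R) ℤ :=
  ((globalSections R Y).mapHomologicalComplex (ComplexShape.up ℤ)).obj I.cochainComplex

/-- The `R`-linear map `R → Γ(Y, 𝒪_Y)`. -/
noncomputable def unitSection {R : Type u} [CommRing R] {Y : Scheme.{u}} (π : Y ⟶ Spec (CommRingCat.of R)) :
    ModuleCat.of R R ⟶ (globalSections R Y).obj (structureSheaf π) :=
  letI := sectionsModule π ⊤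
  ModuleCat.ofHom (LinearMap.toSpanSingleton R Γ(Y, ⊤) 1)

/-- The canonical map `R → Γ(Y, 𝒪_Y) → RΓ(Y, 𝒪_Y)`, where `R` is a complex in degree `0`. -/
noncomputable def derivedSectionsUnit {R : Type u} [CommRing R] {Y : Scheme.{u}} (π : Y ⟶ Spec (CommRingCat.of R))
    (I : InjectiveResolution (structureSheaf π)) :
    HomologicalComplex.tensorUnit (ModuleCat.{u} R) (ComplexShape.up ℤ) ⟶ derivedSections I :=
  (HomologicalComplex.single _ _ 0).map (unitSection π) ≫
    (HomologicalComplex.singleMapHomologicalComplex (globalSections R Y) (ComplexShape.up ℤ) 0).inv.app (structureSheaf π) ≫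
    ((globalSections R Y).mapHomologicalComplex (ComplexShape.up ℤ)).map I.ι'

end StructureSheaf

section DerivedTensor

open CategoryTheory

/-- A K-flat resolution of a complex `K`: a quasi-isomorphism `complex ⟶ K` whose source is K-flat,
i.e. tensoring with it preserves acyclic complexes. -/
structure KFlatResolution {R : Type u} [CommRing R] (K : CochainComplex (ModuleCat.{u} R) ℤ) where
  complex : CochainComplex (ModuleCat.{u} R) ℤ
  hom : complex ⟶ K
  quasiIso : QuasiIso hom
  kflat : ∀ N : CochainComplex (ModuleCat.{u} R) ℤ, N.Acyclic →
    (HomologicalComplex.tensorObj complex N).Acyclic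

attribute [instance] KFlatResolution.quasiIso

/-- `K ⊗ᴸ M`, computed by the total tensor product of a K-flat resolution of `K` with `M`. -/
noncomputable abbrev derivedTensor {R : Type u} [CommRing R]
    {K : CochainComplex (ModuleCat.{u} R) ℤ} (P : KFlatResolution K)
    (M : CochainComplex (ModuleCat.{u} R) ℤ) : CochainComplex (ModuleCat.{u} R) ℤ :=
  HomologicalComplex.tensorObj P.complex M

/-- For maps of complexes `η : R → K` and `ε : R → M`, the natural map `R → H⁰(K ⊗ᴸ M)`, namely
`R → H⁰(K) ≅ H⁰(P) ≅ H⁰(P ⊗ R) → H⁰(P ⊗ M) = H⁰(K ⊗ᴸ M)` induced by `η` and `ε`, where `P` is a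
K-flat resolution of `K`. -/
noncomputable def toDerivedTensorHomology {R : Type u} [CommRing R] {K M : CochainComplex (ModuleCat.{u} R) ℤ}
    (η : HomologicalComplex.tensorUnit (ModuleCat.{u} R) (ComplexShape.up ℤ) ⟶ K)
    (ε : HomologicalComplex.tensorUnit (ModuleCat.{u} R) (ComplexShape.up ℤ) ⟶ M)
    (P : KFlatResolution K) :
    ModuleCat.of R R ⟶ (derivedTensor P M).homology 0 :=
  (HomologicalComplex.singleObjHomologySelfIso (ComplexShape.up ℤ) 0 (ModuleCat.of R R)).inv ≫
    HomologicalComplex.homologyMap η 0 ≫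
    (isoOfQuasiIsoAt P.hom 0).inv ≫
    HomologicalComplex.homologyMap (HomologicalComplex.rightUnitor P.complex).inv 0 ≫
    HomologicalComplex.homologyMap (HomologicalComplex.tensorHom (𝟙 P.complex) ε) 0

end DerivedTensor

end BrianconSkoda

/-! Put N = n + k - 1, let I be the integral closure of J ^ N and let h ∈ I. The aim is to exhibit
the class of 1 ⊗ h as a boundary, by mapping a Koszul-type complex into a K-flat resolution of the
Buchsbaum–Eisenbud complex and writing down an explicit Čech cycle.

Let T be the Koszul complex of the elements f j - X j over R[X] / (X) ^ k. It is a bounded complex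
of free R-modules with basis e_S X ^ α, and it maps to the Buchsbaum–Eisenbud complex: in degree 0
by evaluation X j ↦ f j, in degree p + 1 by the Koszul map on the exponents of degree k - 1
(`twistedEval_twistedBoundary`, `twistedToExtSym_twistedBoundary`). This map carries the unit to the
unit. By projectivity it lifts, up to homotopy, to any K-flat resolution P
(`exists_twistedKoszul_lift`).

On the blowup the loci V j where f j ^ N t does not vanish form an open cover, because a homogeneous
prime containing all f j ^ N t contains J ^ N t and then, by the equations of integral dependence,
all of I t (`exists_notMem_asHomogeneousIdeal`). On the intersection of the V j with j ∈ S consider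
A_S = h ∏_{j ∈ S} (f j - X j)⁻¹ = ∑_α (h / ∏_{j ∈ S} f j ^ (1 + α j)) X ^ α, over α supported in S
and of degree < k. The coefficients are regular sections: after multiplying numerator and
denominator up to ∏_{j ∈ S} f j ^ N, the numerator lies in I ^ |S| exactly because |S| ≤ n
(`mul_prod_pow_mem`). By construction (f j - X j) A_{S ∪ j} is the restriction of A_S
(`mul_blowupCoefficient_insert`), so in the tensor product of T with the augmented Čech complex the
Koszul and Čech differentials of ∑_S e_S A_S cancel (`d_sum_tensorCochain_eq_zero`).

To compare with derived sections, the augmented Čech complex is replaced by E = Hom(C, I'), where C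
is the sheafified augmented chain complex of the cover and I' is the injective resolution of the
structure sheaf. Since C is acyclic and I' is K-injective, E is acyclic, hence so is P ⊗ E, and the
cycle is a boundary there. Evaluation at the empty simplex is a map from E to the derived global
sections. It kills all terms with S ≠ ∅ and turns the cycle into 1 ⊗ h, which is therefore a
boundary. -/

namespace BrianconSkoda

/-! ### Koszul signs and contractions of basis wedges. -/

section KoszulCombinatorics

open TensorProduct

/-- The sign `(-1) ^ #{i ∈ J | i < j}` of `e_{J \ j}` in the contraction of `e_J`. -/
def koszulSign (R : Type u) [CommRing R] {n : ℕ} (j : Fin n) (J : Finset (Fin n)) : R :=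
  (-1) ^ (J.filter (· < j)).card

variable {R : Type u} [CommRing R] {n : ℕ}

theorem koszulSign_mul_self (j : Fin n) (J : Finset (Fin n)) :
    koszulSign R j J * koszulSign R j J = 1 := by
  rw [koszulSign, ← mul_pow]; simp

theorem koszulSign_erase_of_lt {i j : Fin n} {J : Finset (Fin n)} (hi : i ∈ J) (h : i < j) :
    koszulSign R j (J.erase i) = - koszulSign R j J := by
  have h1 : (J.erase i).filter (· < j) = (J.filter (· < j)).erase i := by
    ext x; simp [and_assoc]
  have h2 : i ∈ J.filter (· < j) := by simp [hi, h]
  rw [koszulSign, koszulSign, h1, ← Finset.card_erase_add_one h2, pow_succ]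
  simp

theorem koszulSign_erase_of_le {i j : Fin n} {J : Finset (Fin n)} (h : j ≤ i) :
    koszulSign R j (J.erase i) = koszulSign R j J := by
  have h1 : (J.erase i).filter (· < j) = J.filter (· < j) := by
    ext x
    simp only [Finset.mem_filter, Finset.mem_erase, and_assoc]
    constructor
    · exact fun h => h.2
    · exact fun h' => ⟨fun hx => absurd h'.2 (by simp [hx, h]), h'⟩
  rw [koszulSign, koszulSign, h1]

/-- Deleting the smaller index first shifts the position of the larger one by one; deleting the
larger one first shifts nothing. -/
theorem koszulSign_mul_koszulSign {i j : Fin n} {J : Finset (Fin n)} (hi : i ∈ J) (hj : j ∈ J)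
    (h : i ≠ j) : koszulSign R j J * koszulSign R i (J.erase j) =
      - (koszulSign R i J * koszulSign R j (J.erase i)) := by
  rcases lt_or_gt_of_ne h with h | h
  · rw [koszulSign_erase_of_le h.le, koszulSign_erase_of_lt hi h]; ring
  · rw [koszulSign_erase_of_le h.le, koszulSign_erase_of_lt hj h]; ring

/-- The terms (j, i) and (i, j) cancel. This is the common source of d ∘ d = 0 for the simplex
complex and for the twisted Koszul complex. -/
theorem sum_sum_koszulSign_smul_eq_zero {M : Type*} [AddCommGroup M] [Module R M]
    (J : Finset (Fin n)) (g : Fin n → Fin n → M) (hg : ∀ i j, g i j = g j i) :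
    ∑ j ∈ J, ∑ i ∈ J.erase j, (koszulSign R j J * koszulSign R i (J.erase j)) • g i j = 0 := by
  rw [Finset.sum_sigma']
  refine Finset.sum_involution (fun x _ => ⟨x.2, x.1⟩) ?_ ?_ ?_ ?_
  · rintro ⟨j, i⟩ h
    simp only [Finset.mem_sigma, Finset.mem_erase] at h
    dsimp only
    rw [koszulSign_mul_koszulSign h.2.2 h.1 h.2.1, hg, ← add_smul]
    simp
  · rintro ⟨j, i⟩ h _ h'
    simp only [Finset.mem_sigma, Finset.mem_erase] at h
    simp only [Sigma.mk.injEq] at h'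
    exact h.2.1 h'.1
  · rintro ⟨j, i⟩ h
    simp only [Finset.mem_sigma, Finset.mem_erase] at h ⊢
    exact ⟨h.2.2, h.2.1.symm, h.1⟩
  · rintro ⟨j, i⟩ h
    rfl

/-- The product `e_{j₁} ∧ ⋯ ∧ e_{jᵢ}` for `J = {j₁ < ⋯ < jᵢ}`. -/
noncomputable def wedge (R : Type u) [CommRing R] {n : ℕ} (J : Finset (Fin n)) :
    ExteriorAlgebra R (Fin n → R) :=
  ((J.sort (· ≤ ·)).map fun j => ExteriorAlgebra.ι R (Pi.single j 1 : Fin n → R)).prod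

theorem wedge_empty : wedge R (∅ : Finset (Fin n)) = 1 := by
  simp [wedge]

theorem wedge_insert_of_lt {a : Fin n} {J : Finset (Fin n)} (h : ∀ x ∈ J, a < x) :
    wedge R (insert a J) = ExteriorAlgebra.ι R (Pi.single a 1 : Fin n → R) * wedge R J := by
  rw [wedge, Finset.sort_insert _ (fun x hx => (h x hx).le) (fun ha => lt_irrefl _ (h a ha))]
  simp [wedge]

theorem wedge_mem (J : Finset (Fin n)) : wedge R J ∈ ⋀[R]^(J.card) (Fin n → R) := by
  induction J using Finset.induction_on_min with
  | empty =>
    rw [wedge_empty, Finset.card_empty]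
    change _ ∈ LinearMap.range (ExteriorAlgebra.ι R) ^ 0
    rw [pow_zero]
    exact Submodule.one_le.1 le_rfl
  | insert a J h ih =>
    rw [wedge_insert_of_lt h, Finset.card_insert_of_notMem (fun ha => lt_irrefl _ (h a ha))]
    change _ ∈ LinearMap.range (ExteriorAlgebra.ι R) ^ (J.card + 1)
    rw [pow_succ']
    exact Submodule.mul_mem_mul ⟨_, rfl⟩ ih

/-- Inserting a new minimal index splits off a leftmost factor, so the antiderivation rule applies;
every other sign flips since each remaining index gains one predecessor. -/
theorem contraction_wedge (d : Module.Dual R (Fin n → R)) (J : Finset (Fin n)) :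
    contraction d (wedge R J) =
      ∑ j ∈ J, koszulSign R j J • d (Pi.single j 1) • wedge R (J.erase j) := by
  induction J using Finset.induction_on_min with
  | empty =>
    rw [wedge_empty, Finset.sum_empty]
    exact CliffordAlgebra.contractLeft_one (Q := 0) d
  | insert a J h ih =>
    have ha : a ∉ J := fun ha => lt_irrefl _ (h a ha)
    rw [wedge_insert_of_lt h, Finset.sum_insert ha, Finset.erase_insert ha]
    have h1 : koszulSign R a (insert a J) = 1 := by
      have : (insert a J).filter (· < a) = ∅ := by
        ext x
        simp only [Finset.mem_filter, Finset.mem_insert, Finset.notMem_empty, iff_false, not_and]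
        rintro (rfl | hx)
        · exact lt_irrefl _
        · exact (h x hx).not_gt
      rw [koszulSign, this]; simp
    have h2 : contraction d (ExteriorAlgebra.ι R (Pi.single a 1 : Fin n → R) * wedge R J) =
        d (Pi.single a 1) • wedge R J -
          ExteriorAlgebra.ι R (Pi.single a 1 : Fin n → R) * contraction d (wedge R J) :=
      CliffordAlgebra.contractLeft_ι_mul _ _ _
    rw [h2, h1, one_smul, ih, sub_eq_add_neg, Finset.mul_sum, ← Finset.sum_neg_distrib]
    congr 1
    refine Finset.sum_congr rfl fun j hj => ?_
    have haj : a < j := h j hj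
    have h3 : (insert a J).erase j = insert a (J.erase j) :=
      Finset.erase_insert_of_ne haj.ne
    have h4 : koszulSign R j (insert a J) = - koszulSign R j J := by
      have := koszulSign_erase_of_lt (R := R) (Finset.mem_insert_self a J) haj
      rw [Finset.erase_insert ha] at this
      rw [this, neg_neg]
    rw [h3, wedge_insert_of_lt (fun x hx => h x (Finset.mem_of_mem_erase hx)), h4,
      mul_smul_comm, mul_smul_comm, neg_smul]

end KoszulCombinatorics

/-! ### The augmented chain complex of a simplex and its contraction. -/

section SimplexComplex

variable {R : Type u} [CommRing R] {n : ℕ}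

/-- The boundary map of the augmented oriented chain complex of a simplex. -/
noncomputable def simplexBoundary (R : Type u) [CommRing R] (n : ℕ) :
    (Finset (Fin n) →₀ R) →ₗ[R] (Finset (Fin n) →₀ R) :=
  Finsupp.linearCombination R fun J => ∑ j ∈ J, koszulSign R j J • Finsupp.single (J.erase j) 1

theorem simplexBoundary_single (J : Finset (Fin n)) :
    simplexBoundary R n (Finsupp.single J 1) =
      ∑ j ∈ J, koszulSign R j J • Finsupp.single (J.erase j) 1 := by
  simp [simplexBoundary]

theorem simplexBoundary_simplexBoundary (x : Finset (Fin n) →₀ R) :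
    simplexBoundary R n (simplexBoundary R n x) = 0 := by
  suffices h : simplexBoundary R n ∘ₗ simplexBoundary R n = 0 from LinearMap.congr_fun h x
  refine Finsupp.lhom_ext' fun J => LinearMap.ext_ring ?_
  simp only [LinearMap.comp_apply, Finsupp.lsingle_apply, simplexBoundary_single, map_sum, map_smul,
    LinearMap.zero_apply, Finset.smul_sum, smul_smul]
  refine sum_sum_koszulSign_smul_eq_zero (R := R) J
    (fun i j => Finsupp.single ((J.erase j).erase i) (1 : R)) fun i j => ?_
  rw [Finset.erase_right_comm]

/-- The contraction of the augmented chain complex of a simplex to the vertex `a`. -/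
noncomputable def simplexHomotopy (R : Type u) [CommRing R] {n : ℕ} (a : Fin n) :
    (Finset (Fin n) →₀ R) →ₗ[R] (Finset (Fin n) →₀ R) :=
  Finsupp.linearCombination R fun J =>
    if a ∈ J then 0 else koszulSign R a (insert a J) • Finsupp.single (insert a J) 1

theorem simplexHomotopy_single (a : Fin n) (J : Finset (Fin n)) :
    simplexHomotopy R a (Finsupp.single J 1) =
      if a ∈ J then 0 else koszulSign R a (insert a J) • Finsupp.single (insert a J) 1 := by
  simp [simplexHomotopy]

/-- The cone construction. If a ∈ J, only the face opposite a contributes to the second term; if a ∉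
J, the faces of the cone other than J cancel against the cones over the faces of J. -/
theorem simplexBoundary_simplexHomotopy_add (a : Fin n) (x : Finset (Fin n) →₀ R) :
    simplexBoundary R n (simplexHomotopy R a x) + simplexHomotopy R a (simplexBoundary R n x) =
      x := by
  suffices h : simplexBoundary R n ∘ₗ simplexHomotopy R a +
      simplexHomotopy R a ∘ₗ simplexBoundary R n = LinearMap.id from LinearMap.congr_fun h x
  refine Finsupp.lhom_ext' fun J => LinearMap.ext_ring ?_
  simp only [LinearMap.comp_apply, LinearMap.add_apply, Finsupp.lsingle_apply,
    simplexBoundary_single, simplexHomotopy_single, map_sum, map_smul, LinearMap.id_apply]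
  by_cases ha : a ∈ J
  · rw [if_pos ha, map_zero, zero_add, Finset.sum_eq_single_of_mem a ha]
    · rw [if_neg (Finset.notMem_erase a J), Finset.insert_erase ha, smul_smul,
        koszulSign_mul_self, one_smul]
    · intro i _ hia
      rw [if_pos (Finset.mem_erase.2 ⟨hia.symm, ha⟩), smul_zero]
  · rw [if_neg ha, map_smul, simplexBoundary_single, Finset.sum_insert ha, Finset.erase_insert ha,
      smul_add, smul_smul, koszulSign_mul_self, one_smul, add_assoc, Finset.smul_sum,
      ← Finset.sum_add_distrib, Finset.sum_eq_zero, add_zero]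
    intro i hi
    have hia : i ≠ a := fun h => ha (h ▸ hi)
    have h1 : insert a (J.erase i) = (insert a J).erase i :=
      (Finset.erase_insert_of_ne hia.symm).symm
    have h2 := koszulSign_mul_koszulSign (R := R) (Finset.mem_insert_of_mem hi)
      (Finset.mem_insert_self a J) hia
    rw [Finset.erase_insert ha] at h2
    rw [if_neg (fun h => ha (Finset.mem_of_mem_erase h)), h1, smul_smul, smul_smul, ← add_smul]
    have h3 := koszulSign_mul_self (R := R) a (insert a J)
    have h4 := koszulSign_mul_self (R := R) i (insert a J)
    have h5 := koszulSign_mul_self (R := R) i J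
    have h6 := koszulSign_mul_self (R := R) a ((insert a J).erase i)
    have : koszulSign R a (insert a J) * koszulSign R i (insert a J) +
        koszulSign R i J * koszulSign R a ((insert a J).erase i) = 0 := by
      generalize koszulSign R a (insert a J) = p at *
      generalize koszulSign R i (insert a J) = q at *
      generalize koszulSign R i J = r at *
      generalize koszulSign R a ((insert a J).erase i) = s at *
      -- The sign rule p * r = -(q * s) is multiplied by q * r, and squares of signs are 1.
      linear_combination (q * r) * h2 + (-p*q) * h5 + (- r * s) * h4
    rw [this, zero_smul]

/-- The transposed form of the boundary. Dualised, it becomes the Čech differential on cochains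
concentrated on one simplex. -/
theorem simplexBoundary_apply (x : Finset (Fin n) →₀ R) (J : Finset (Fin n)) :
    simplexBoundary R n x J = ∑ j ∈ Jᶜ, koszulSign R j (insert j J) * x (insert j J) := by
  suffices h : Finsupp.lapply J ∘ₗ simplexBoundary R n =
      ∑ j ∈ Jᶜ, koszulSign R j (insert j J) • Finsupp.lapply (M := R) (insert j J) by
    simpa using LinearMap.congr_fun h x
  refine Finsupp.lhom_ext' fun K => LinearMap.ext_ring ?_
  simp only [LinearMap.comp_apply, Finsupp.lsingle_apply, simplexBoundary_single, map_sum, map_smul,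
    LinearMap.sum_apply, LinearMap.smul_apply, Finsupp.lapply_apply, Finsupp.single_apply,
    smul_eq_mul, mul_ite, mul_one, mul_zero]
  rw [← Finset.sum_filter, ← Finset.sum_filter]
  refine Finset.sum_congr ?_ ?_
  · ext j
    simp only [Finset.mem_filter, Finset.mem_compl]
    constructor
    · rintro ⟨hj, rfl⟩
      exact ⟨Finset.notMem_erase _ _, (Finset.insert_erase hj).symm⟩
    · rintro ⟨hj, rfl⟩
      exact ⟨Finset.mem_insert_self _ _, Finset.erase_insert hj⟩
  · intro j hj
    rw [(Finset.mem_filter.1 hj).2]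

end SimplexComplex

/-! ### The Koszul complex of f j - X j over R[X] / (X) ^ k and its map to the Buchsbaum–Eisenbud
complex. -/

section TwistedKoszul

open TensorProduct

variable {R : Type u} [CommRing R] {n : ℕ}

theorem koszulMap_wedge_tmul (J : Finset (Fin n)) (s : MvPolynomial (Fin n) R) :
    koszulMap R n (wedge R J ⊗ₜ s) =
      ∑ j ∈ J, koszulSign R j J • (wedge R (J.erase j) ⊗ₜ[R] (MvPolynomial.X j * s)) := by
  simp only [koszulMap, LinearMap.sum_apply, TensorProduct.map_tmul, contraction_wedge,
    LinearMap.mulLeft_apply, TensorProduct.sum_tmul, TensorProduct.smul_tmul']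
  rw [Finset.sum_comm]
  refine Finset.sum_congr rfl fun j _ => ?_
  rw [Finset.sum_eq_single j]
  · simp
  · intro i _ hij
    simp [hij]
  · simp

theorem contractionMap_wedge_tmul (f : Fin n → R) (J : Finset (Fin n))
    (s : MvPolynomial (Fin n) R) :
    contractionMap f (wedge R J ⊗ₜ s) =
      ∑ j ∈ J, koszulSign R j J • f j • (wedge R (J.erase j) ⊗ₜ[R] s) := by
  simp only [contractionMap, TensorProduct.map_tmul, contraction_wedge,
    LinearMap.id_apply, TensorProduct.sum_tmul, TensorProduct.smul_tmul']
  refine Finset.sum_congr rfl fun j _ => ?_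
  rw [Fintype.linearCombination_apply_single, smul_eq_mul, one_mul]

/-- Contractions with coordinate forms anticommute while multiplications by variables commute. -/
theorem koszulMap_koszulMap (x : ExtSym R n) : koszulMap R n (koszulMap R n x) = 0 := by
  induction x using TensorProduct.induction_on with
  | zero => simp
  | tmul a b =>
    simp only [koszulMap, LinearMap.sum_apply, TensorProduct.map_tmul, map_sum,
      LinearMap.mulLeft_apply, contraction]
    rw [← Finset.sum_product']
    refine Finset.sum_involution (fun p _ => p.swap) ?_ ?_ ?_ ?_
    · rintro ⟨i, j⟩ -
      dsimp only [Prod.swap_prod_mk]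
      rw [CliffordAlgebra.contractLeft_comm, TensorProduct.neg_tmul, mul_left_comm,
        neg_add_cancel]
    · rintro ⟨i, j⟩ - h h'
      rw [Prod.swap_prod_mk, Prod.mk.injEq] at h'
      dsimp only at h
      rw [h'.1, CliffordAlgebra.contractLeft_contractLeft, TensorProduct.zero_tmul] at h
      exact h rfl
    · simp
    · simp
  | add a b ha hb => simp only [map_add, ha, hb, add_zero]

/-- The free module with basis the `e_J X ^ α`; with `twistedBoundary` it underlies the Koszul complex
of the elements `f j - X j` over `R[X] / (X) ^ k`. -/
abbrev TwistedKoszul (R : Type u) [CommRing R] (n : ℕ) : Type u :=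
  (Finset (Fin n) × (Fin n →₀ ℕ)) →₀ R

/-- Multiplication by `f j - X j`, where monomials of degree `≥ k` are discarded. -/
noncomputable def truncMul (f : Fin n → R) (k : ℕ) (j : Fin n) :
    TwistedKoszul R n →ₗ[R] TwistedKoszul R n :=
  Finsupp.linearCombination R fun b => f j • Finsupp.single b 1 -
    if b.2.degree + 1 < k then Finsupp.single (b.1, b.2 + Finsupp.single j 1) 1 else 0

theorem truncMul_single (f : Fin n → R) (k : ℕ) (j : Fin n) (b : Finset (Fin n) × (Fin n →₀ ℕ)) :
    truncMul f k j (Finsupp.single b 1) = f j • Finsupp.single b 1 -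
      if b.2.degree + 1 < k then Finsupp.single (b.1, b.2 + Finsupp.single j 1) 1 else 0 := by
  simp [truncMul]

theorem truncMul_comm (f : Fin n → R) (k : ℕ) (i j : Fin n) (x : TwistedKoszul R n) :
    truncMul f k i (truncMul f k j x) = truncMul f k j (truncMul f k i x) := by
  suffices h : truncMul f k i ∘ₗ truncMul f k j = truncMul f k j ∘ₗ truncMul f k i from
    LinearMap.congr_fun h x
  refine Finsupp.lhom_ext' fun b => LinearMap.ext_ring ?_
  simp only [LinearMap.comp_apply, Finsupp.lsingle_apply, truncMul_single, map_sub, map_smul]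
  by_cases h : b.2.degree + 1 < k
  · simp only [if_pos h, truncMul_single, map_add, Finsupp.degree_single]
    rw [add_right_comm b.2, smul_sub, smul_sub, smul_smul, smul_smul, mul_comm]
    abel
  · simp only [if_neg h, map_zero, sub_zero, smul_smul, mul_comm]

/-- The Koszul differential for the elements `f j - X j` of `R[X] / (X) ^ k`. -/
noncomputable def twistedBoundary (f : Fin n → R) (k : ℕ) :
    TwistedKoszul R n →ₗ[R] TwistedKoszul R n :=
  Finsupp.linearCombination R fun b =>
    ∑ j ∈ b.1, koszulSign R j b.1 • truncMul f k j (Finsupp.single (b.1.erase j, b.2) 1)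

theorem twistedBoundary_single (f : Fin n → R) (k : ℕ) (b : Finset (Fin n) × (Fin n →₀ ℕ)) :
    twistedBoundary f k (Finsupp.single b 1) =
      ∑ j ∈ b.1, koszulSign R j b.1 • truncMul f k j (Finsupp.single (b.1.erase j, b.2) 1) := by
  simp [twistedBoundary]

theorem twistedBoundary_truncMul (f : Fin n → R) (k : ℕ) (j : Fin n) (x : TwistedKoszul R n) :
    twistedBoundary f k (truncMul f k j x) = truncMul f k j (twistedBoundary f k x) := by
  suffices h : twistedBoundary f k ∘ₗ truncMul f k j = truncMul f k j ∘ₗ twistedBoundary f k from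
    LinearMap.congr_fun h x
  refine Finsupp.lhom_ext' fun b => LinearMap.ext_ring ?_
  simp only [LinearMap.comp_apply, Finsupp.lsingle_apply, twistedBoundary_single, map_sum, map_smul]
  rw [truncMul_single, map_sub, map_smul, twistedBoundary_single]
  have h1 : ∀ i, truncMul f k j (truncMul f k i (Finsupp.single (b.1.erase i, b.2) 1)) =
      f j • truncMul f k i (Finsupp.single (b.1.erase i, b.2) 1) -
        if b.2.degree + 1 < k then
          truncMul f k i (Finsupp.single (b.1.erase i, b.2 + Finsupp.single j 1) 1) else 0 := by
    intro i
    rw [truncMul_comm, truncMul_single f k j, map_sub, map_smul]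
    split_ifs <;> simp
  simp only [h1, smul_sub, Finset.sum_sub_distrib, Finset.smul_sum, smul_comm (f j)]
  congr 1
  split_ifs
  · rw [twistedBoundary_single]
  · simp

theorem twistedBoundary_twistedBoundary (f : Fin n → R) (k : ℕ) (x : TwistedKoszul R n) :
    twistedBoundary f k (twistedBoundary f k x) = 0 := by
  suffices h : twistedBoundary f k ∘ₗ twistedBoundary f k = 0 from LinearMap.congr_fun h x
  refine Finsupp.lhom_ext' fun b => LinearMap.ext_ring ?_
  simp only [LinearMap.comp_apply, Finsupp.lsingle_apply, twistedBoundary_single, map_sum, map_smul,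
    LinearMap.zero_apply, twistedBoundary_truncMul, Finset.smul_sum, smul_smul]
  refine sum_sum_koszulSign_smul_eq_zero (R := R) b.1 (fun i j => truncMul f k j
    (truncMul f k i (Finsupp.single ((b.1.erase j).erase i, b.2) 1))) fun i j => ?_
  rw [Finset.erase_right_comm, truncMul_comm]

/-- The component `R[X] / (X) ^ k → R` in degree `0` of the map from the twisted Koszul complex to the
Buchsbaum–Eisenbud complex. -/
noncomputable def twistedEval (f : Fin n → R) (k : ℕ) : TwistedKoszul R n →ₗ[R] R :=
  Finsupp.linearCombination R fun b =>
    if b.1 = ∅ ∧ b.2.degree < k then MvPolynomial.aeval f (MvPolynomial.monomial b.2 (1 : R)) else 0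

/-- The component in degree `p + 1` of the map from the twisted Koszul complex to the
Buchsbaum–Eisenbud complex. -/
noncomputable def twistedToExtSym (R : Type u) [CommRing R] (n k p : ℕ) :
    TwistedKoszul R n →ₗ[R] ExtSym R n :=
  Finsupp.linearCombination R fun b =>
    if b.1.card = p + 1 ∧ b.2.degree + 1 = k then
      (-1 : R) ^ p • koszulMap R n (wedge R b.1 ⊗ₜ MvPolynomial.monomial b.2 1) else 0

theorem twistedEval_single (f : Fin n → R) (k : ℕ) (b : Finset (Fin n) × (Fin n →₀ ℕ)) :
    twistedEval f k (Finsupp.single b 1) =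
      if b.1 = ∅ ∧ b.2.degree < k then
        MvPolynomial.aeval f (MvPolynomial.monomial b.2 (1 : R)) else 0 := by
  simp [twistedEval]

theorem twistedToExtSym_single (k p : ℕ) (b : Finset (Fin n) × (Fin n →₀ ℕ)) :
    twistedToExtSym R n k p (Finsupp.single b 1) =
      if b.1.card = p + 1 ∧ b.2.degree + 1 = k then
        (-1 : R) ^ p • koszulMap R n (wedge R b.1 ⊗ₜ MvPolynomial.monomial b.2 1) else 0 := by
  simp [twistedToExtSym]

theorem twistedToExtSym_mem (k p : ℕ) (x : TwistedKoszul R n) :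
    twistedToExtSym R n k p x ∈ beTerm R n k (p + 1) := by
  induction x using Finsupp.induction_linear with
  | zero => simp
  | add x y hx hy => rw [map_add]; exact add_mem hx hy
  | single b r =>
    rw [← mul_one r, ← smul_eq_mul, ← Finsupp.smul_single, map_smul, twistedToExtSym_single]
    refine Submodule.smul_mem _ _ ?_
    split_ifs with h
    · refine Submodule.smul_mem _ _ ⟨_, ⟨⟨wedge R b.1, ?_⟩ ⊗ₜ ⟨MvPolynomial.monomial b.2 1, ?_⟩, rfl⟩,
        rfl⟩
      · rw [← h.1]; exact wedge_mem b.1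
      · rw [MvPolynomial.mem_homogeneousSubmodule]
        exact MvPolynomial.isHomogeneous_monomial _ (by omega)
    · exact zero_mem _

theorem X_mul_monomial (j : Fin n) (α : Fin n →₀ ℕ) :
    (MvPolynomial.X j * MvPolynomial.monomial α 1 : MvPolynomial (Fin n) R) =
      MvPolynomial.monomial (α + Finsupp.single j 1) 1 := by
  rw [MvPolynomial.X, MvPolynomial.monomial_mul, one_mul, add_comm]

/-- Only exponents of degree k - 1 survive on the target side. In that degree the shift by X j is
truncated away and the boundary is contraction with f; it anticommutes with the Koszul map, which
the signs (-1) ^ p absorb. From degree k - 2 the shifts land in degree k - 1, and their total is the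
Koszul map applied twice, hence zero. In all other degrees both sides vanish termwise. -/
theorem twistedToExtSym_twistedBoundary (f : Fin n → R) (k p : ℕ) (x : TwistedKoszul R n) :
    twistedToExtSym R n k p (twistedBoundary f k x) =
      contractionMap f (twistedToExtSym R n k (p + 1) x) := by
  suffices h : twistedToExtSym R n k p ∘ₗ twistedBoundary f k =
    contractionMap f ∘ₗ twistedToExtSym R n k (p + 1) from LinearMap.congr_fun h x
  refine Finsupp.lhom_ext' fun b => LinearMap.ext_ring ?_
  simp only [LinearMap.comp_apply, Finsupp.lsingle_apply, twistedBoundary_single, map_sum, map_smul,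
    twistedToExtSym_single]
  simp only [truncMul_single, map_sub, map_smul, apply_ite (twistedToExtSym R n k p), map_zero]
  simp only [twistedToExtSym_single, map_add, Finsupp.degree_single]
  by_cases hc : b.1.card = p + 1 + 1
  · have hc' : ∀ j ∈ b.1, (b.1.erase j).card = p + 1 := fun j hj => by
      rw [Finset.card_erase_of_mem hj, hc]; rfl
    by_cases hd : b.2.degree + 1 = k
    · rw [if_pos ⟨hc, hd⟩, map_smul, contractionMap_koszulMap, contractionMap_wedge_tmul,
        pow_succ, ← smul_smul, map_sum, neg_smul, one_smul, neg_neg]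
      rw [Finset.smul_sum]
      refine Finset.sum_congr rfl fun j hj => ?_
      rw [if_pos ⟨hc' j hj, hd⟩, if_neg (by omega), sub_zero, map_smul, map_smul,
        smul_comm ((-1 : R) ^ p), smul_comm ((-1 : R) ^ p)]
    · rw [if_neg (fun h => hd h.2), map_zero]
      by_cases hd' : b.2.degree + 2 = k
      · have h0 := koszulMap_koszulMap (wedge R b.1 ⊗ₜ[R] MvPolynomial.monomial b.2 (1 : R))
        rw [koszulMap_wedge_tmul, map_sum] at h0
        have h1 : ∀ j ∈ b.1, koszulSign R j b.1 •
            ((f j • if (b.1.erase j).card = p + 1 ∧ b.2.degree + 1 = k then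
              (-1 : R) ^ p • koszulMap R n (wedge R (b.1.erase j) ⊗ₜ MvPolynomial.monomial b.2 1)
                else 0) -
            if b.2.degree + 1 < k then if (b.1.erase j).card = p + 1 ∧ b.2.degree + 1 + 1 = k then
              (-1 : R) ^ p • koszulMap R n (wedge R (b.1.erase j) ⊗ₜ
                MvPolynomial.monomial (b.2 + Finsupp.single j 1) 1) else 0 else 0) =
            -((-1 : R) ^ p • koszulMap R n (koszulSign R j b.1 • (wedge R (b.1.erase j) ⊗ₜ[R]
              (MvPolynomial.X j * MvPolynomial.monomial b.2 1)))) := by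
          intro j hj
          rw [if_neg (fun h => hd h.2), if_pos (by omega), if_pos ⟨hc' j hj, by omega⟩,
            X_mul_monomial, smul_zero, zero_sub, smul_neg, map_smul, smul_comm]
        rw [Finset.sum_congr rfl h1, Finset.sum_neg_distrib, ← Finset.smul_sum, h0, smul_zero,
          neg_zero]
      · refine Finset.sum_eq_zero fun j hj => ?_
        rw [if_neg (fun h => hd h.2), if_neg (c := _ ∧ b.2.degree + 1 + 1 = k) (fun h => hd' h.2)]
        simp
  · rw [if_neg (fun h => hc h.1), map_zero]
    refine Finset.sum_eq_zero fun j hj => ?_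
    have hc' : (b.1.erase j).card ≠ p + 1 := by
      rw [Finset.card_erase_of_mem hj]
      have := Finset.card_pos.2 ⟨j, hj⟩
      omega
    rw [if_neg (fun h => hc' h.1), if_neg (c := (b.1.erase j).card = p + 1 ∧ _) (fun h => hc' h.1)]
    simp

theorem evalMap_wedge_tmul (f : Fin n → R) (J : Finset (Fin n)) (s : MvPolynomial (Fin n) R) :
    evalMap f (wedge R J ⊗ₜ s) = if J = ∅ then MvPolynomial.aeval f s else 0 := by
  have h : evalMap f (wedge R J ⊗ₜ s) = ExteriorAlgebra.algebraMapInv (wedge R J) *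
      MvPolynomial.aeval f s := rfl
  rw [h]
  split_ifs with hJ
  · rw [hJ, wedge_empty, map_one, one_mul]
  · have : ExteriorAlgebra.algebraMapInv (wedge R J) = (0 : R) := by
      induction J using Finset.induction_on_min with
      | empty => exact absurd rfl hJ
      | insert a J ha _ => rw [wedge_insert_of_lt ha, map_mul]; simp [ExteriorAlgebra.algebraMapInv]
    rw [this, zero_mul]

/-- Evaluation at f kills multiplication by f j - X j except where truncation intervenes. For
exponents of degree k - 1 the X j term is discarded and what remains is f j times the monomial in f,
the value of the degree k monomial given by the Koszul map. -/
theorem twistedEval_twistedBoundary (f : Fin n → R) (k : ℕ) (x : TwistedKoszul R n) :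
    twistedEval f k (twistedBoundary f k x) = evalMap f (twistedToExtSym R n k 0 x) := by
  suffices h : twistedEval f k ∘ₗ twistedBoundary f k = evalMap f ∘ₗ twistedToExtSym R n k 0 from
    LinearMap.congr_fun h x
  refine Finsupp.lhom_ext' fun b => LinearMap.ext_ring ?_
  simp only [LinearMap.comp_apply, Finsupp.lsingle_apply, twistedBoundary_single, map_sum, map_smul,
    twistedToExtSym_single]
  simp only [truncMul_single, map_sub, map_smul, apply_ite (twistedEval f k), map_zero]
  simp only [twistedEval_single, map_add, Finsupp.degree_single, ← X_mul_monomial, map_mul,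
    MvPolynomial.aeval_X]
  by_cases hd : b.2.degree + 1 = k
  · have hd2 : b.2.degree < k := by omega
    have hd3 : ¬ b.2.degree + 1 < k := by omega
    by_cases hc : b.1.card = 0 + 1
    · rw [if_pos ⟨hc, hd⟩, map_smul, evalMap_koszulMap, contractionMap_wedge_tmul, map_sum,
        pow_zero, one_smul]
      refine Finset.sum_congr rfl fun j hj => ?_
      rw [if_neg hd3, sub_zero, map_smul, map_smul, evalMap_wedge_tmul]
      simp [hd2]
    · rw [if_neg (fun h => hc h.1), map_zero]
      refine Finset.sum_eq_zero fun j hj => ?_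
      have : b.1.erase j ≠ ∅ := fun h => hc (by
        rw [← Finset.card_erase_add_one hj, h, Finset.card_empty])
      simp [this, hd3]
  · rw [if_neg (fun h => hd h.2), map_zero]
    refine Finset.sum_eq_zero fun j _ => ?_
    have : b.2.degree < k ↔ b.2.degree + 1 < k := by omega
    simp only [this]
    by_cases h : b.2.degree + 1 < k <;> simp [h]

end TwistedKoszul

/-! ### Lifting maps from K-projective complexes through quasi-isomorphisms. -/

section Lifting

open CategoryTheory

/-- Morphisms out of a K-projective complex are the same in the homotopy category and in the derived
category, and in the latter q is invertible. -/
theorem exists_lift_of_isKProjective {C : Type*} [Category* C] [Abelian C]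
    {Q P K : CochainComplex C ℤ} [Q.IsKProjective] (φ : Q ⟶ K) (q : P ⟶ K) [QuasiIso q] :
    ∃ σ : Q ⟶ P, Nonempty (Homotopy (σ ≫ q) φ) := by
  let := HasDerivedCategory.standard C
  let e := DerivedCategory.quotientCompQhIso C
  obtain ⟨g, hg⟩ := (CochainComplex.IsKProjective.Qh_map_bijective Q _).surjective
    (e.hom.app Q ≫ DerivedCategory.Q.map φ ≫ inv (DerivedCategory.Q.map q) ≫ e.inv.app P)
  obtain ⟨σ, rfl⟩ := (HomotopyCategory.quotient C (.up ℤ)).map_surjective g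
  refine ⟨σ, ⟨HomotopyCategory.homotopyOfEq _ _ ?_⟩⟩
  apply (CochainComplex.IsKProjective.Qh_map_bijective Q _).injective
  have h1 := e.hom.naturality q
  have h2 := e.hom.naturality φ
  dsimp at h1 h2
  rw [Functor.map_comp, Functor.map_comp, hg, ← cancel_mono (e.hom.app K)]
  rw [Category.assoc, h1, h2, Category.assoc, Category.assoc, Category.assoc,
    Iso.inv_hom_id_app_assoc, IsIso.inv_hom_id, Category.comp_id]

end Lifting

/-! ### The twisted Koszul complex as a complex of projectives, and its lift to a K-flat resolution.
-/

section TwistedComplex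

open CategoryTheory

theorem embeddingDownNat_f_zero : ComplexShape.embeddingDownNat.f 0 = 0 := rfl

theorem comp_inv_comp_hom_comp {C : Type*} [Category* C] {X₁ X₂ X₃ X₄ X₅ X₆ : C} (a : X₁ ⟶ X₂)
    (b : X₂ ⟶ X₃) (i : X₄ ≅ X₃) (c : X₃ ⟶ X₅) (d : X₅ ⟶ X₆) :
    (a ≫ b ≫ i.inv) ≫ i.hom ≫ c ≫ d = a ≫ (b ≫ c) ≫ d := by
  simp

variable {R : Type u} [CommRing R] {n : ℕ}

/-- The Koszul complex of the elements `f j - X j` over `R[X] / (X) ^ k` (extended by zero maps). -/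
noncomputable def twistedComplex (f : Fin n → R) (k : ℕ) : ChainComplex (ModuleCat.{u} R) ℕ :=
  ChainComplex.of (fun _ => ModuleCat.of R (TwistedKoszul R n))
    (fun _ => ModuleCat.ofHom (twistedBoundary f k))
    (fun _ => by
      rw [← ModuleCat.ofHom_comp]
      exact congrArg ModuleCat.ofHom (LinearMap.ext (twistedBoundary_twistedBoundary f k)))

theorem twistedComplex_d (f : Fin n → R) (k p : ℕ) :
    (twistedComplex f k).d (p + 1) p = ModuleCat.ofHom (twistedBoundary f k) :=
  ChainComplex.of_d (fun _ => ModuleCat.of R (TwistedKoszul R n))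
    (fun _ => ModuleCat.ofHom (twistedBoundary f k)) p

theorem beChainComplex_d_succ (f : Fin n → R) (k p : ℕ) :
    (beChainComplex f k).d (p + 2) (p + 1) = ModuleCat.ofHom (beDiff f k (p + 1)) :=
  (ChainComplex.augment_d_succ_succ _ _ _ _ _).trans
    (ChainComplex.of_d (fun i => ModuleCat.of R (beTerm R n k (i + 1)))
      (fun i => ModuleCat.ofHom (beDiff f k (i + 1))) p)

/-- The components of `twistedToBuchsbaumEisenbud`. -/
noncomputable def twistedToBuchsbaumEisenbudX (f : Fin n → R) (k : ℕ) :
    ∀ p, (twistedComplex f k).X p ⟶ (beChainComplex f k).X p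
  | 0 => ModuleCat.ofHom (twistedEval f k)
  | p + 1 => ModuleCat.ofHom ((twistedToExtSym R n k p).codRestrict (beTerm R n k (p + 1))
      (twistedToExtSym_mem k p))

/-- The map from the twisted Koszul complex to the Buchsbaum–Eisenbud complex. -/
noncomputable def twistedToBuchsbaumEisenbud (f : Fin n → R) (k : ℕ) :
    twistedComplex f k ⟶ beChainComplex f k where
  f := twistedToBuchsbaumEisenbudX f k
  comm' := by
    rintro _ (_ | p) rfl
    · rw [twistedComplex_d]
      exact ModuleCat.hom_ext (LinearMap.ext fun x => (twistedEval_twistedBoundary f k x).symm)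
    · rw [twistedComplex_d]
      refine (congrArg (_ ≫ ·) (beChainComplex_d_succ f k p)).trans ?_
      exact ModuleCat.hom_ext (LinearMap.ext fun x => Subtype.ext
        (twistedToExtSym_twistedBoundary f k p x).symm)

/-- Every term is free on all pairs (J, α). The superfluous basis elements, with |J| different from
the degree or with α of degree at least k, are harmless: the map to the Buchsbaum–Eisenbud complex
kills them. -/
instance twistedComplex_projective (f : Fin n → R) (k p : ℕ) :
    Projective ((twistedComplex f k).X p) :=
  inferInstanceAs (Projective (ModuleCat.of R (TwistedKoszul R n)))

/-- The inclusion of `R`, as the span of the basis vector `1` in degree `0`, in the twisted Koszul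
complex. -/
noncomputable def twistedUnit (f : Fin n → R) (k : ℕ) :
    HomologicalComplex.tensorUnit (ModuleCat.{u} R) (ComplexShape.up ℤ) ⟶
      (twistedComplex f k).extend ComplexShape.embeddingDownNat :=
  HomologicalComplex.mkHomFromSingle
    (ModuleCat.ofHom (LinearMap.toSpanSingleton R (TwistedKoszul R n)
      (Finsupp.single (∅, 0) 1)) ≫
      ((twistedComplex f k).extendXIso ComplexShape.embeddingDownNat (i := 0) (i' := 0) embeddingDownNat_f_zero).inv)
    (fun j hj => by
      have : Limits.IsZero
          (((twistedComplex f k).extend ComplexShape.embeddingDownNat).X j) := by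
        refine HomologicalComplex.isZero_extend_X _ _ _ fun i hi => ?_
        simp at hi hj
        omega
      exact this.eq_of_tgt _ _)

theorem twistedUnit_f_zero (f : Fin n → R) (k : ℕ) : (twistedUnit f k).f 0 =
    (HomologicalComplex.singleObjXSelf (ComplexShape.up ℤ) 0 (ModuleCat.of R R)).hom ≫
      ModuleCat.ofHom (LinearMap.toSpanSingleton R (TwistedKoszul R n) (Finsupp.single (∅, 0) 1)) ≫
      ((twistedComplex f k).extendXIso ComplexShape.embeddingDownNat (i := 0) (i' := 0) embeddingDownNat_f_zero).inv :=
  HomologicalComplex.mkHomFromSingle_f _ _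

theorem buchsbaumEisenbudUnit_f_zero (f : Fin n → R) (k : ℕ) : (buchsbaumEisenbudUnit f k).f 0 =
    (HomologicalComplex.singleObjXSelf (ComplexShape.up ℤ) 0 (ModuleCat.of R R)).hom ≫
      ((beChainComplex f k).extendXIso ComplexShape.embeddingDownNat (i := 0) (i' := 0) embeddingDownNat_f_zero).inv :=
  HomologicalComplex.mkHomFromSingle_f _ _

theorem toSpanSingleton_comp_twistedToBuchsbaumEisenbud (f : Fin n → R) {k : ℕ} (hk : 1 ≤ k) :
    (ModuleCat.ofHom (LinearMap.toSpanSingleton R (TwistedKoszul R n)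
      (Finsupp.single (∅, 0) 1)) : ModuleCat.of R R ⟶ (twistedComplex f k).X 0) ≫
        (twistedToBuchsbaumEisenbud f k).f 0 = 𝟙 (ModuleCat.of R R) := by
  refine ModuleCat.hom_ext (LinearMap.ext_ring ?_)
  change twistedEval f k ((1 : R) • Finsupp.single (∅, 0) 1) = 1
  rw [one_smul, twistedEval_single, if_pos ⟨rfl, by simpa using Nat.pos_of_ne_zero (by omega)⟩]
  simp

/-- `twistedToBuchsbaumEisenbud` as a map of cochain complexes. -/
noncomputable def twistedExtendMap (f : Fin n → R) (k : ℕ) :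
    (twistedComplex f k).extend ComplexShape.embeddingDownNat ⟶ buchsbaumEisenbud f k :=
  HomologicalComplex.extendMap (twistedToBuchsbaumEisenbud f k) ComplexShape.embeddingDownNat

theorem twistedUnit_comp (f : Fin n → R) {k : ℕ} (hk : 1 ≤ k) :
    twistedUnit f k ≫ twistedExtendMap f k = buchsbaumEisenbudUnit f k := by
  apply HomologicalComplex.from_single_hom_ext
  refine ((HomologicalComplex.comp_f _ _ _).trans
    (congrArg₂ (· ≫ ·) (twistedUnit_f_zero f k)
      (HomologicalComplex.extendMap_f _ ComplexShape.embeddingDownNat (i := 0) (i' := 0) embeddingDownNat_f_zero))).trans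
    (Eq.trans ?_ (buchsbaumEisenbudUnit_f_zero f k).symm)
  have h := congrArg (· ≫ ((beChainComplex f k).extendXIso ComplexShape.embeddingDownNat
    (i := 0) (i' := 0) embeddingDownNat_f_zero).inv) (toSpanSingleton_comp_twistedToBuchsbaumEisenbud f hk)
  refine Eq.trans ?_ (congrArg (_ ≫ ·) (h.trans (Category.id_comp _)))
  exact comp_inv_comp_hom_comp _ _ _ _ _

/-- The lift is packaged as linear maps `b p` and a unit `v`, so that later computations can be done
on elements. Compatibility of `v` with the unit of the Buchsbaum–Eisenbud complex holds only up to
homotopy, which suffices on homology. The resolution may have nonzero terms in positive degrees, so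
the vanishing of the differential on the image of `b 0` has to be recorded separately. -/
theorem exists_twistedKoszul_lift (f : Fin n → R) {k : ℕ} (hk : 1 ≤ k)
    (P : KFlatResolution (buchsbaumEisenbud f k)) :
    ∃ (b : ∀ (p : ℕ) (i : ℤ), i = -p → TwistedKoszul R n →ₗ[R] P.complex.X i)
      (v : HomologicalComplex.tensorUnit (ModuleCat.{u} R) (ComplexShape.up ℤ) ⟶ P.complex),
      (∀ p i j hi hj x, (P.complex.d i j).hom (b (p + 1) i hi x) =
        b p j hj (twistedBoundary f k x)) ∧
      (∀ j x, (P.complex.d 0 j).hom (b 0 0 rfl x) = 0) ∧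
      HomologicalComplex.homologyMap (v ≫ P.hom) 0 =
        HomologicalComplex.homologyMap (buchsbaumEisenbudUnit f k) 0 ∧
      ∀ r : R, (v.f 0).hom ((HomologicalComplex.singleObjXSelf (ComplexShape.up ℤ) 0
        (ModuleCat.of R R)).inv.hom r) = b 0 0 rfl (Finsupp.single (∅, 0) r) := by
  have := P.quasiIso
  -- K-projectivity holds because the extended complex is bounded above with projective terms.
  obtain ⟨σ, ⟨hσ⟩⟩ := @exists_lift_of_isKProjective _ _ _ _ _ _ inferInstance
    (twistedExtendMap f k) P.hom P.quasiIso
  refine ⟨fun p i hi => (((twistedComplex f k).extendXIso ComplexShape.embeddingDownNat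
    (i := p) (i' := i) hi.symm).inv ≫ σ.f i).hom, twistedUnit f k ≫ σ, ?_, ?_, ?_, ?_⟩
  · intro p i j hi hj x
    have h := σ.comm i j
    rw [HomologicalComplex.extend_d_eq _ _ (i := p + 1) (j := p) hi.symm hj.symm,
      twistedComplex_d] at h
    have h2 : ((twistedComplex f k).extendXIso ComplexShape.embeddingDownNat
        (i := p + 1) (i' := i) hi.symm).inv ≫ σ.f i ≫ P.complex.d i j =
        ModuleCat.ofHom (twistedBoundary f k) ≫ ((twistedComplex f k).extendXIso
          ComplexShape.embeddingDownNat (i := p) (i' := j) hj.symm).inv ≫ σ.f j := by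
      rw [h]
      simp only [Category.assoc, Iso.inv_hom_id_assoc]
      exact Category.assoc _ _ _
    exact LinearMap.congr_fun (congrArg ModuleCat.Hom.hom h2) x
  · intro j x
    have h : ((twistedComplex f k).extend ComplexShape.embeddingDownNat).d 0 j = 0 := by
      by_cases hj : (0 : ℤ) + 1 = j
      · exact (HomologicalComplex.isZero_extend_X _ _ _ fun i hi => by
          simp at hi; omega).eq_of_tgt _ _
      · exact HomologicalComplex.shape _ _ _ hj
    have h1 : (((twistedComplex f k).extendXIso ComplexShape.embeddingDownNat
        (i := 0) (i' := 0) embeddingDownNat_f_zero).inv ≫ σ.f 0) ≫ P.complex.d 0 j = 0 := by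
      rw [Category.assoc, σ.comm, h, Limits.zero_comp, Limits.comp_zero]
    exact LinearMap.congr_fun (congrArg ModuleCat.Hom.hom h1) x
  · rw [Category.assoc, ← twistedUnit_comp f hk, HomologicalComplex.homologyMap_comp,
      hσ.homologyMap_eq 0, ← HomologicalComplex.homologyMap_comp]
  · intro r
    rw [HomologicalComplex.comp_f, twistedUnit, HomologicalComplex.mkHomFromSingle_f]
    have h : (Finsupp.single (∅, 0) r : TwistedKoszul R n) =
      LinearMap.toSpanSingleton R (TwistedKoszul R n) (Finsupp.single (∅, 0) 1) r := by simp
    rw [h, ← ModuleCat.comp_apply]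
    simp only [Category.assoc]
    rfl

end TwistedComplex

/-! ### Global functions and fractions on Proj. -/

section ProjSections

open AlgebraicGeometry CategoryTheory Opposite TopologicalSpace HomogeneousLocalization

theorem topIso_inv_comp_appTop {X : Scheme.{u}} {U : X.Opens} (h : U = ⊤) :
    U.topIso.inv ≫ ((Scheme.topIso X).inv ≫ (Scheme.isoOfEq X h).inv).appTop =
      X.presheaf.map (eqToHom h.symm).op := by
  subst h
  have h1 := congrArg Scheme.Hom.appTop (Scheme.toIso_inv_ι X)
  rw [Scheme.Hom.comp_appTop, Scheme.Opens.ι_appTop] at h1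
  rw [Scheme.isoOfEq_rfl, Iso.refl_inv, Category.comp_id]
  simp at h1 ⊢
  exact h1

variable {A σ : Type u} [CommRing A] [SetLike σ A] [AddSubgroupClass σ A]
    (𝒜 : ℕ → σ) [GradedRing 𝒜]

/-- The structure map of Proj is defined through the basic open set of 1, which equals the whole
space only propositionally; the formula isolates the resulting transport as a restriction map. -/
theorem toSpecZero_appTop :
    (Scheme.ΓSpecIso (.of (𝒜 0))).inv ≫ (Proj.toSpecZero 𝒜).appTop =
      CommRingCat.ofHom (fromZeroRingHom 𝒜 _) ≫ Proj.awayToSection 𝒜 1 ≫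
      (Proj 𝒜).presheaf.map (eqToHom (Proj.basicOpen_one 𝒜).symm).op := by
  rw [Proj.toSpecZero, ← Category.assoc (Scheme.topIso _).inv, Scheme.Hom.comp_appTop,
    Scheme.Hom.comp_appTop,
    ← topIso_inv_comp_appTop (Proj.basicOpen_one 𝒜)]
  have h2 : (Proj.basicOpenToSpec 𝒜 1).appTop = _ := Proj.basicOpenToSpec_app_top 𝒜 1
  simp only [Category.assoc]
  rw [h2, ← Scheme.ΓSpecIso_inv_naturality_assoc]
  simp only [Category.assoc, Iso.inv_hom_id_assoc]

/-- The section `r / s` of the structure sheaf of `Proj` on an open subset on which `s` does not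
vanish. -/
noncomputable def fracSection (U : (Proj 𝒜).Opens) {i : ℕ} (r s : 𝒜 i)
    (hs : ∀ x : ProjectiveSpectrum 𝒜, x ∈ U → s.1 ∉ x.asHomogeneousIdeal) : Γ(Proj 𝒜, U) :=
  (⟨fun x => HomogeneousLocalization.mk ⟨i, r, s, hs x.1 x.2⟩,
    fun x => ⟨U, x.2, 𝟙 U, i, r, s, fun y => hs y.1 y.2, fun _ => rfl⟩⟩ :
      (ProjectiveSpectrum.Proj.structureSheaf 𝒜).1.obj (op U))

theorem fracSection_mul {U : (Proj 𝒜).Opens} {i i' i'' : ℕ} {r s : 𝒜 i} {r' s' : 𝒜 i'}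
    {r'' s'' : 𝒜 i''}
    (hs : ∀ x : ProjectiveSpectrum 𝒜, x ∈ U → s.1 ∉ x.asHomogeneousIdeal)
    (hs' : ∀ x : ProjectiveSpectrum 𝒜, x ∈ U → s'.1 ∉ x.asHomogeneousIdeal)
    (hs'' : ∀ x : ProjectiveSpectrum 𝒜, x ∈ U → s''.1 ∉ x.asHomogeneousIdeal)
    (h : r.1 * r'.1 * s''.1 = r''.1 * (s.1 * s'.1)) :
    fracSection 𝒜 U r s hs * fracSection 𝒜 U r' s' hs' = fracSection 𝒜 U r'' s'' hs'' := by
  refine Subtype.ext (funext fun x => ?_)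
  change HomogeneousLocalization.mk (𝒜 := 𝒜) _ * HomogeneousLocalization.mk _ =
    HomogeneousLocalization.mk _
  rw [HomogeneousLocalization.ext_iff_val, val_mul, val_mk, val_mk, val_mk, Localization.mk_mul,
    Localization.mk_eq_mk_iff, Localization.r_iff_exists]
  refine ⟨1, ?_⟩
  simp only [OneMemClass.coe_one, one_mul]
  rw [mul_comm, h, mul_comm]
  rfl

end ProjSections

/-! ### Elements of R as fractions on the blowup. -/

section Blowup

open AlgebraicGeometry CategoryTheory Opposite TopologicalSpace

variable {R : Type u} [CommRing R]

theorem algebraToSections_comp {X Y : Scheme.{u}} (p : X ⟶ Spec (CommRingCat.of R)) (g : Y ⟶ X)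
    {U : X.Opens} {V : Y.Opens} (e : V ≤ g ⁻¹ᵁ U) (r : R) :
    (g.appLE U V e).hom (algebraToSections p U r) = algebraToSections (g ≫ p) V r := by
  unfold algebraToSections
  rw [← CommRingCat.comp_apply]
  congr 2
  simp only [Scheme.Hom.comp_appTop, Scheme.Hom.appLE, Category.assoc, Scheme.Hom.naturality_assoc,
    ← Functor.map_comp]
  rfl

theorem one_notMem_asHomogeneousIdeal {A σ : Type u} [CommRing A] [SetLike σ A]
    [AddSubgroupClass σ A] (𝒜 : ℕ → σ) [GradedRing 𝒜] (x : ProjectiveSpectrum 𝒜) :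
    ((1 : 𝒜 0) : A) ∉ x.asHomogeneousIdeal :=
  (Ideal.ne_top_iff_one _).1 x.isPrime.ne_top

theorem algebraToSections_blowupMap (I : Ideal R) (U : (blowup I).Opens) (r : R) :
    algebraToSections (blowupMap I) U r = fracSection (reesGrading I) U
      (algebraMap R (reesGrading I 0) r) 1
      (fun x _ => one_notMem_asHomogeneousIdeal (reesGrading I) x) := by
  have h : (Scheme.ΓSpecIso (CommRingCat.of R)).inv ≫ (blowupMap I).appTop =
      CommRingCat.ofHom (algebraMap R (reesGrading I 0)) ≫
        (Scheme.ΓSpecIso (.of (reesGrading I 0))).inv ≫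
          (Proj.toSpecZero (reesGrading I)).appTop := by
    rw [Scheme.ΓSpecIso_inv_naturality_assoc]
    exact congrArg (_ ≫ ·) (Scheme.Hom.comp_appTop _ _)
  unfold algebraToSections
  rw [← Category.assoc, h, toSpecZero_appTop]
  rfl

end Blowup

/-! ### The loci where f j ^ N t does not vanish cover the blowup. -/

section IntegralClosureCover

variable {R : Type u} [CommRing R]

theorem le_idealIntegralClosure (I : Ideal R) : I ≤ idealIntegralClosure I := by
  intro x hx
  refine ⟨1, fun _ => -x, ?_, ?_⟩
  · intro i hi
    rw [Finset.Icc_self, Finset.mem_singleton] at hi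
    subst hi
    rw [pow_one]
    exact neg_mem hx
  · simp

/-- The element `r tⁱ` of the Rees algebra. -/
noncomputable def reesMonomial (I : Ideal R) (i : ℕ) (r : R) (hr : r ∈ I ^ i) : reesGrading I i :=
  ⟨⟨Polynomial.monomial i r, reesAlgebra.monomial_mem.2 hr⟩, ⟨r, rfl⟩⟩

theorem reesMonomial_mul {I : Ideal R} {i j : ℕ} {r s : R} (hr : r ∈ I ^ i) (hs : s ∈ I ^ j) :
    (reesMonomial I i r hr).1 * (reesMonomial I j s hs).1 =
      (reesMonomial I (i + j) (r * s) (pow_add I i j ▸ Ideal.mul_mem_mul hr hs)).1 :=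
  Subtype.ext (Polynomial.monomial_mul_monomial _ _ _ _)

theorem reesMonomial_congr {I : Ideal R} {i j : ℕ} {r s : R} (hr : r ∈ I ^ i) (hs : s ∈ I ^ j)
    (hij : i = j) (hrs : r = s) : (reesMonomial I i r hr).1 = (reesMonomial I j s hs).1 := by
  subst hij hrs; rfl

theorem prod_reesMonomial {I : Ideal R} {ι : Type*} (s : Finset ι) (r : ι → R)
    (hr : ∀ i, r i ∈ I ^ 1) (h : ∏ i ∈ s, r i ∈ I ^ s.card) :
    ∏ i ∈ s, (reesMonomial I 1 (r i) (hr i)).1 = (reesMonomial I s.card (∏ i ∈ s, r i) h).1 := by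
  classical
  induction s using Finset.induction_on with
  | empty => exact Subtype.ext Polynomial.monomial_zero_one.symm
  | insert a s ha ih =>
    have h' : ∏ i ∈ s, r i ∈ I ^ s.card :=
      (Finset.prod_const (M := Ideal R) (s := s) I) ▸ Ideal.prod_mem_prod fun i _ => by
        simpa using hr i
    rw [Finset.prod_insert ha, ih h', reesMonomial_mul]
    refine reesMonomial_congr _ _ ?_ (Finset.prod_insert ha).symm
    rw [Finset.card_insert_of_notMem ha, add_comm]

/-- The ideal of all `r` such that `r tⁱ` lies in the ideal `p` of the Rees algebra. -/
def primeTrace (I : Ideal R) (p : Ideal (reesAlgebra I)) (i : ℕ) : Ideal R where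
  carrier := {r | ∃ y ∈ p, (y : Polynomial R) = Polynomial.monomial i r}
  zero_mem' := ⟨0, zero_mem _, (map_zero _).symm⟩
  add_mem' := by
    rintro a b ⟨y, hy, hy'⟩ ⟨z, hz, hz'⟩
    exact ⟨y + z, add_mem hy hz, by rw [map_add, ← hy', ← hz']; rfl⟩
  smul_mem' := by
    rintro c a ⟨y, hy, hy'⟩
    refine ⟨algebraMap R (reesAlgebra I) c * y, Ideal.mul_mem_left _ _ hy, ?_⟩
    rw [smul_eq_mul, ← Polynomial.C_mul_monomial, ← hy']
    rfl

theorem mem_primeTrace_iff {I : Ideal R} {p : Ideal (reesAlgebra I)} {i : ℕ} {r : R}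
    (hr : r ∈ I ^ i) : r ∈ primeTrace I p i ↔ (reesMonomial I i r hr).1 ∈ p :=
  ⟨fun ⟨y, hy, hy'⟩ => by
    rwa [show (reesMonomial I i r hr).1 = y from Subtype.ext hy'.symm], fun h => ⟨_, h, rfl⟩⟩

theorem mul_mem_primeTrace {I : Ideal R} {p : Ideal (reesAlgebra I)} {i j : ℕ} {r s : R}
    (hr : r ∈ primeTrace I p i) (hs : s ∈ I ^ j) : r * s ∈ primeTrace I p (i + j) := by
  obtain ⟨y, hy, hy'⟩ := hr
  refine ⟨y * (reesMonomial I j s hs).1, Ideal.mul_mem_right _ _ hy, ?_⟩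
  rw [← Polynomial.monomial_mul_monomial, ← hy']
  rfl

theorem primeTrace_le {I : Ideal R} {p : Ideal (reesAlgebra I)} {i : ℕ} :
    primeTrace I p i ≤ I ^ i := fun _ ⟨y, _, hy'⟩ =>
  reesAlgebra.monomial_mem.1 (hy' ▸ y.2)

/-- The d-th power of r t is r ^ d t ^ d, so primality extracts the root. -/
theorem mem_primeTrace_of_pow_mem {I : Ideal R} {p : Ideal (reesAlgebra I)} [p.IsPrime] {r : R}
    (hr : r ∈ I) {d : ℕ} (h : r ^ d ∈ primeTrace I p d) : r ∈ primeTrace I p 1 := by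
  have hr' : r ∈ I ^ 1 := by rwa [pow_one]
  rw [mem_primeTrace_iff hr']
  refine Ideal.IsPrime.mem_of_pow_mem ‹_› d ?_
  obtain ⟨y, hy, hy'⟩ := h
  convert hy
  exact Subtype.ext ((Polynomial.monomial_pow _ _ _).trans (by rw [one_mul, hy']))

/-- One factor in the trace is enough, the others only need to lie in I; this is why the exponent is
at least 1. -/
theorem pow_le_primeTrace {I K : Ideal R} {p : Ideal (reesAlgebra I)} (h : K ≤ primeTrace I p 1)
    (i : ℕ) : K ^ (i + 1) ≤ primeTrace I p (i + 1) := by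
  induction i with
  | zero => rwa [zero_add, pow_one]
  | succ i ih =>
    rw [pow_succ, Ideal.mul_le]
    intro r hr s hs
    exact mul_mem_primeTrace (ih hr) (primeTrace_le (h hs))

/-- It suffices to treat a product of N of the generators. Its N-th power is a product of N elements
of the form f j ^ N: the first lies in the trace of p, the others in I. So the N-th power lies in
the trace in degree N, and primality applies. -/
theorem span_range_pow_le_primeTrace {n N : ℕ} (hN : 1 ≤ N) (f : Fin n → R) {I : Ideal R}
    (hI : Ideal.span (Set.range f) ^ N ≤ I) (p : Ideal (reesAlgebra I)) [p.IsPrime]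
    (hp : ∀ j, f j ^ N ∈ primeTrace I p 1) :
    Ideal.span (Set.range f) ^ N ≤ primeTrace I p 1 := by
  rw [Ideal.span, Submodule.span_pow, Submodule.span_le]
  intro x hx
  obtain ⟨g, rfl⟩ := Set.mem_pow.1 hx
  rw [List.prod_ofFn]
  choose c hc using fun i => (g i).2
  have hx : ∏ i, (g i : R) ∈ I := hI (by
    rw [Ideal.span, Submodule.span_pow]
    exact Submodule.subset_span (by rwa [List.prod_ofFn] at hx))
  refine mem_primeTrace_of_pow_mem hx (d := N) ?_
  obtain ⟨N, rfl⟩ : ∃ M, N = M + 1 := ⟨N - 1, by omega⟩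
  have h1 : ∀ i, (g i : R) ^ (N + 1) ∈ primeTrace I p 1 := fun i => by
    rw [← hc i]; exact hp (c i)
  have h2 : ∀ s : Finset (Fin N), ∏ i ∈ s, (g i.succ : R) ^ (N + 1) ∈ I ^ s.card := fun s => by
    rw [← Finset.prod_const]
    exact Ideal.prod_mem_prod fun i _ => by simpa using primeTrace_le (h1 i.succ)
  have h3 := mul_mem_primeTrace (h1 0) (h2 Finset.univ)
  rw [Finset.card_univ, Fintype.card_fin, add_comm 1 N] at h3
  rwa [← Finset.prod_pow, Fin.prod_univ_succ]

/-- In an equation of integral dependence for x, each a i x ^ (d - i) lies in the trace in degree d,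
since a i ∈ K ^ i does so in degree i ≥ 1 and x lies in the integral closure. Hence x ^ d lies in
the trace, and then x. -/
theorem idealIntegralClosure_le_primeTrace {K : Ideal R}
    (p : Ideal (reesAlgebra (idealIntegralClosure K))) [p.IsPrime]
    (hK : K ≤ primeTrace (idealIntegralClosure K) p 1) :
    idealIntegralClosure K ≤ primeTrace (idealIntegralClosure K) p 1 := by
  rintro x ⟨d, a, ha, h⟩
  have hx : x ∈ idealIntegralClosure K := ⟨d, a, ha, h⟩
  refine mem_primeTrace_of_pow_mem hx (d := d) ?_
  rw [eq_neg_of_add_eq_zero_left h]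
  refine neg_mem (sum_mem fun i hi => ?_)
  have hi' := Finset.mem_Icc.1 hi
  obtain ⟨j, rfl⟩ : ∃ j, i = j + 1 := ⟨i - 1, by omega⟩
  have h1 := mul_mem_primeTrace (pow_le_primeTrace hK j (ha (j + 1) hi))
    (Ideal.pow_mem_pow hx (d - (j + 1)))
  rwa [show j + 1 + (d - (j + 1)) = d by omega] at h1

/-- Otherwise the prime would contain the whole degree 1 part of the Rees algebra, hence every
element of positive degree, contradicting relevance. -/
theorem exists_notMem_asHomogeneousIdeal {n N : ℕ} (hN : 1 ≤ N) (f : Fin n → R) {J : Ideal R}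
    (hJ : J = Ideal.span (Set.range f))
    (hf : ∀ j, f j ^ N ∈ idealIntegralClosure (J ^ N) ^ 1)
    (x : ProjectiveSpectrum (reesGrading (idealIntegralClosure (J ^ N)))) :
    ∃ j, (reesMonomial (idealIntegralClosure (J ^ N)) 1 (f j ^ N) (hf j)).1 ∉
      x.asHomogeneousIdeal := by
  subst hJ
  by_contra! hx
  have := x.isPrime
  have h1 := idealIntegralClosure_le_primeTrace x.asHomogeneousIdeal.toIdeal
    (span_range_pow_le_primeTrace hN f (le_idealIntegralClosure _) _
      fun j => (mem_primeTrace_iff (hf j)).2 (hx j))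
  refine x.not_irrelevant_le ?_
  rw [HomogeneousIdeal.irrelevant_le]
  rintro (_ | i) hi y ⟨r, hr⟩
  · exact absurd hi (lt_irrefl _)
  · obtain ⟨z, hz, hz'⟩ := pow_le_primeTrace h1 i
      (reesAlgebra.monomial_mem.1 (show Polynomial.monomial (i + 1) r ∈ _ from hr ▸ y.2))
    rwa [show y = z from Subtype.ext (hr.symm.trans hz'.symm)]

end IntegralClosureCover

/-! ### The sections h / ∏ f j ^ (1 + α j) and their recursion. -/

section Coefficients

open AlgebraicGeometry CategoryTheory Opposite TopologicalSpace

theorem mem_finset_inf_opens {X ι : Type*} [TopologicalSpace X] {s : Finset ι} {U : ι → Opens X}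
    {x : X} : x ∈ s.inf U ↔ ∀ i ∈ s, x ∈ U i := by
  rw [← SetLike.mem_coe, Opens.coe_finset_inf]
  simp

variable {R : Type u} [CommRing R] {n : ℕ}

/-- The numerical heart of the theorem. With N = n + k - 1 and S nonempty, the exponents sum to at
least |S| (N - 1) - (k - 1) = N (|S| - 1) + (n - |S|), so the product lies in (J ^ N) ^ (|S| - 1),
and h supplies the last factor from I. The slack n - |S| is nonnegative and is 0 when S is the full
index set. -/
theorem mul_prod_pow_mem (f : Fin n → R) {k : ℕ} {I J : Ideal R} (hf : ∀ j, f j ∈ J)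
    (hI : J ^ (n + k - 1) ≤ I) {h : R} (hh : h ∈ I) (S : Finset (Fin n)) (α : Fin n →₀ ℕ)
    (hα : α.degree < k) :
    h * ∏ j ∈ S, f j ^ (n + k - 1 - 1 - α j) ∈ I ^ S.card := by
  rcases S.eq_empty_or_nonempty with rfl | hS
  · simp
  obtain ⟨m, hm⟩ : ∃ m, S.card = m + 1 := ⟨S.card - 1, by have := hS.card_pos; omega⟩
  have hmn : m + 1 ≤ n := hm ▸ (Finset.card_le_univ S).trans_eq (Fintype.card_fin n)
  rw [hm, pow_succ']
  refine Ideal.mul_mem_mul hh (Ideal.pow_right_mono hI m ?_)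
  rw [← pow_mul]
  refine Ideal.pow_le_pow_right ?_ ((Finset.prod_pow_eq_pow_sum S _ J) ▸
    Ideal.prod_mem_prod fun j _ => Ideal.pow_mem_pow (hf j) _ : _ ∈ J ^ (∑ j ∈ S, _))
  have h1 : ∑ j ∈ S, α j ≤ α.degree := by
    rw [Finsupp.degree_eq_sum]
    exact Finset.sum_le_univ_sum_of_nonneg fun _ => Nat.zero_le _
  have h2 : ∑ j ∈ S, (n + k - 1 - 1) ≤ ∑ j ∈ S, (n + k - 1 - 1 - α j) + ∑ j ∈ S, α j := by
    rw [← Finset.sum_add_distrib]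
    exact Finset.sum_le_sum fun j _ => by omega
  rw [Finset.sum_const, hm, smul_eq_mul] at h2
  obtain ⟨N, hN⟩ : ∃ N, n + k - 1 = N + 1 := ⟨n + k - 1 - 1, by omega⟩
  rw [hN] at h2 ⊢
  rw [Nat.add_sub_cancel] at h2 ⊢
  have h3 : (m + 1) * N = N * m + N := by ring
  have h4 : (N + 1) * m = N * m + m := by ring
  rw [h3] at h2
  rw [h4]
  omega

/-- The open subset of the blowup of `I` on which none of the elements `r j t`, `j ∈ S`,
vanishes. -/
noncomputable def blowupChart (I : Ideal R) (r : Fin n → R) (hr : ∀ j, r j ∈ I ^ 1) (j : Fin n) :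
    (blowup I).Opens :=
  Proj.basicOpen (reesGrading I) (reesMonomial I 1 (r j) (hr j)).1

theorem prod_mem_pow_card {I : Ideal R} {r : Fin n → R} (hr : ∀ j, r j ∈ I ^ 1)
    (S : Finset (Fin n)) : ∏ j ∈ S, r j ∈ I ^ S.card :=
  (Finset.prod_const (M := Ideal R) (s := S) I) ▸ Ideal.prod_mem_prod fun i _ => by
        simpa using hr i

theorem prod_reesMonomial_notMem {I : Ideal R} {r : Fin n → R} (hr : ∀ j, r j ∈ I ^ 1)
    (S : Finset (Fin n)) (x : ProjectiveSpectrum (reesGrading I))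
    (hx : x ∈ S.inf (blowupChart I r hr)) :
    (reesMonomial I S.card (∏ j ∈ S, r j) (prod_mem_pow_card hr S)).1 ∉ x.asHomogeneousIdeal := by
  have := x.isPrime
  rw [← prod_reesMonomial S r hr]
  intro h
  obtain ⟨j, hj, hj'⟩ := (Ideal.IsPrime.prod_mem_iff).1 h
  exact mem_finset_inf_opens.1 hx j hj hj'

/-- The section `r tⁱ / s tⁱ` of the structure sheaf of the blowup of `I`. -/
noncomputable def blowupFrac (I : Ideal R) (U : (blowup I).Opens) (i : ℕ) {r s : R} (hr : r ∈ I ^ i)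
    (hs : s ∈ I ^ i) (hU : ∀ x : ProjectiveSpectrum (reesGrading I), x ∈ U →
      (reesMonomial I i s hs).1 ∉ x.asHomogeneousIdeal) : Γ(blowup I, U) :=
  fracSection (reesGrading I) U (reesMonomial I i r hr) (reesMonomial I i s hs) hU

theorem map_blowupFrac {I : Ideal R} {U V : (blowup I).Opens} (hUV : U ≤ V) {i : ℕ} {r s : R}
    (hr : r ∈ I ^ i) (hs : s ∈ I ^ i) (hV : ∀ x : ProjectiveSpectrum (reesGrading I), x ∈ V →
      (reesMonomial I i s hs).1 ∉ x.asHomogeneousIdeal) :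
    ((blowup I).presheaf.map (homOfLE hUV).op).hom (blowupFrac I V i hr hs hV) =
      blowupFrac I U i hr hs (fun x hx => hV x (hUV hx)) := rfl

theorem algebraToSections_eq_blowupFrac (I : Ideal R) (U : (blowup I).Opens) (r : R) :
    algebraToSections (blowupMap I) U r = blowupFrac I U 0 (r := r) (s := 1) (by simp) (by simp)
      (fun x _ => one_notMem_asHomogeneousIdeal (reesGrading I) x) :=
  algebraToSections_blowupMap I U r

theorem algebraToSections_mul_blowupFrac {I : Ideal R} {U : (blowup I).Opens} {i i' : ℕ}
    {a r s r' s' : R} (hr : r ∈ I ^ i) (hs : s ∈ I ^ i) (hr' : r' ∈ I ^ i') (hs' : s' ∈ I ^ i')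
    (hU : ∀ x : ProjectiveSpectrum (reesGrading I), x ∈ U →
      (reesMonomial I i s hs).1 ∉ x.asHomogeneousIdeal)
    (hU' : ∀ x : ProjectiveSpectrum (reesGrading I), x ∈ U →
      (reesMonomial I i' s' hs').1 ∉ x.asHomogeneousIdeal) (h : a * r * s' = r' * s) :
    algebraToSections (blowupMap I) U a * blowupFrac I U i hr hs hU =
      blowupFrac I U i' hr' hs' hU' := by
  rw [algebraToSections_eq_blowupFrac]
  refine fracSection_mul _ _ _ _ ?_
  simp only [reesMonomial_mul]
  exact reesMonomial_congr _ _ (by omega) (by rw [one_mul, h])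

open Classical in
/-- The section `h / ∏ f j ^ (1 + α j)` of the structure sheaf of the blowup, the product being
over `j ∈ S`. -/
noncomputable def blowupCoefficient (f : Fin n → R) {k : ℕ} {I J : Ideal R} (hf : ∀ j, f j ∈ J)
    (hI : J ^ (n + k - 1) ≤ I) (hfI : ∀ j, f j ^ (n + k - 1) ∈ I ^ 1) {h : R} (hh : h ∈ I)
    (S : Finset (Fin n)) (α : Fin n →₀ ℕ) :
    Γ(blowup I, S.inf (blowupChart I (fun j => f j ^ (n + k - 1)) hfI)) :=
  if hα : α.degree < k ∧ α.support ⊆ S then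
    blowupFrac I _ S.card (mul_prod_pow_mem f hf hI hh S α hα.1) (prod_mem_pow_card hfI S)
      (prod_reesMonomial_notMem hfI S)
  else 0

theorem blowupCoefficient_empty (f : Fin n → R) {k : ℕ} (hk : 1 ≤ k) {I J : Ideal R}
    (hf : ∀ j, f j ∈ J) (hI : J ^ (n + k - 1) ≤ I) (hfI : ∀ j, f j ^ (n + k - 1) ∈ I ^ 1)
    {h : R} (hh : h ∈ I) :
    blowupCoefficient f hf hI hfI hh ∅ 0 = algebraToSections (blowupMap I) _ h := by
  rw [blowupCoefficient, dif_pos ⟨by simpa using Nat.pos_of_ne_zero (by omega), by simp⟩, ← mul_one (algebraToSections _ _ h),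
    ← map_one (algebraToSections (blowupMap I) _), algebraToSections_eq_blowupFrac I _ 1]
  exact (algebraToSections_mul_blowupFrac _ _ _ _ _ _ (by simp)).symm

/-- The coefficient of X ^ α in (f j - X j) A_{S ∪ j} = A_S, where A_S expands h ∏_{i ∈ S} (f i - X
i)⁻¹. If α j = 0 the shifted term is absent; if α j > 0 then α is not supported in S and the term of
A_S is absent; if α is not supported in S ∪ j everything vanishes. -/
theorem mul_blowupCoefficient_insert (f : Fin n → R) {k : ℕ} {I J : Ideal R}
    (hf : ∀ j, f j ∈ J) (hI : J ^ (n + k - 1) ≤ I) (hfI : ∀ j, f j ^ (n + k - 1) ∈ I ^ 1)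
    {h : R} (hh : h ∈ I) (S : Finset (Fin n)) (j : Fin n) (hj : j ∉ S) (α : Fin n →₀ ℕ)
    (hα : α.degree < k) :
    algebraToSections (blowupMap I) _ (f j) * blowupCoefficient f hf hI hfI hh (insert j S) α =
      ((blowup I).presheaf.map (homOfLE (Finset.inf_mono (Finset.subset_insert j S))).op).hom
        (blowupCoefficient f hf hI hfI hh S α) +
      if α j = 0 then 0
        else blowupCoefficient f hf hI hfI hh (insert j S) (α - Finsupp.single j 1) := by
  classical
  have h0 : α j ≤ α.degree := Finsupp.le_degree j α
  have h1 : (α - Finsupp.single j 1).degree ≤ α.degree := Finsupp.degree_mono tsub_le_self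
  have hn : 1 ≤ n := j.pos
  by_cases hS : α.support ⊆ insert j S
  · rw [blowupCoefficient, dif_pos ⟨hα, hS⟩]
    split_ifs with hαj
    · have hS' : α.support ⊆ S := fun i hi => ((Finset.mem_insert.1 (hS hi)).resolve_left
        (by rintro rfl; exact (Finsupp.mem_support_iff.1 hi) hαj))
      rw [add_zero, blowupCoefficient, dif_pos ⟨hα, hS'⟩, map_blowupFrac]
      refine algebraToSections_mul_blowupFrac _ _ _ _ _ _ ?_
      have : f j ^ (n + k - 1) = f j * f j ^ (n + k - 1 - 1) := by
        rw [← pow_succ']; congr 1; omega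
      rw [Finset.prod_insert hj, Finset.prod_insert hj, hαj, tsub_zero, this]
      ring
    · rw [blowupCoefficient, dif_neg, map_zero, zero_add, blowupCoefficient,
        dif_pos ⟨h1.trans_lt hα, (Finsupp.support_mono tsub_le_self).trans hS⟩]
      · refine algebraToSections_mul_blowupFrac _ _ _ _ _ _ ?_
        rw [Finset.prod_insert hj, Finset.prod_insert hj, Finset.prod_insert hj]
        have h2 : ∏ i ∈ S, f i ^ (n + k - 1 - 1 - (α - Finsupp.single j 1 : Fin n →₀ ℕ) i) =
            ∏ i ∈ S, f i ^ (n + k - 1 - 1 - α i) := Finset.prod_congr rfl fun i hi => by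
          rw [Finsupp.tsub_apply, Finsupp.single_eq_of_ne (by rintro rfl; exact hj hi), tsub_zero]
        have : f j ^ (n + k - 1 - 1 - (α - Finsupp.single j 1 : Fin n →₀ ℕ) j) =
            f j * f j ^ (n + k - 1 - 1 - α j) := by
          rw [← pow_succ', Finsupp.tsub_apply, Finsupp.single_eq_same]; congr 1; omega
        rw [this, h2]
        ring
      · exact fun h => hj (h.2 (Finsupp.mem_support_iff.2 hαj))
  · obtain ⟨i, hi, hi'⟩ := Finset.not_subset.1 hS
    have hij : i ≠ j := fun h => hi' (h ▸ Finset.mem_insert_self _ _)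
    have hi'' : i ∈ (α - Finsupp.single j 1).support := by
      rwa [Finsupp.mem_support_iff, Finsupp.tsub_apply, Finsupp.single_eq_of_ne hij, tsub_zero,
        ← Finsupp.mem_support_iff]
    rw [blowupCoefficient, dif_neg fun h => hS h.2, mul_zero, blowupCoefficient,
      dif_neg fun h => hi' (Finset.mem_insert_of_mem (h.2 hi)), map_zero, zero_add,
      blowupCoefficient, dif_neg fun h => hi' (h.2 hi''), ite_self]

/-- Both the cover and the coefficients are pulled back along g, so nothing about Y beyond the
morphism to the blowup is needed. -/
theorem exists_coefficients (f : Fin n → R) {k : ℕ} (hn : 1 ≤ n) (hk : 1 ≤ k) {J : Ideal R}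
    (hJ : J = Ideal.span (Set.range f)) {Y : Scheme.{u}}
    (g : Y ⟶ blowup (idealIntegralClosure (J ^ (n + k - 1)))) {h : R}
    (hh : h ∈ idealIntegralClosure (J ^ (n + k - 1))) :
    ∃ (V : Fin n → Y.Opens) (_ : ⨆ j, V j = ⊤)
      (a : ∀ (S : Finset (Fin n)), (Fin n →₀ ℕ) → Γ(Y, S.inf V)),
      a ∅ 0 = algebraToSections (g ≫ blowupMap _) _ h ∧ (∀ α ≠ 0, a ∅ α = 0) ∧
      ∀ (S : Finset (Fin n)) (j : Fin n), j ∉ S → ∀ α : Fin n →₀ ℕ, α.degree < k →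
        algebraToSections (g ≫ blowupMap _) _ (f j) * a (insert j S) α =
          (Y.presheaf.map (homOfLE (Finset.inf_mono (Finset.subset_insert j S))).op).hom (a S α) +
            if α j = 0 then 0 else a (insert j S) (α - Finsupp.single j 1) := by
  have hf : ∀ j, f j ∈ J := fun j => hJ ▸ Ideal.subset_span ⟨j, rfl⟩
  have hI := le_idealIntegralClosure (J ^ (n + k - 1))
  have hfI : ∀ j, f j ^ (n + k - 1) ∈ idealIntegralClosure (J ^ (n + k - 1)) ^ 1 := fun j => by
    rw [pow_one]; exact hI (Ideal.pow_mem_pow (hf j) _)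
  let U := blowupChart _ _ hfI
  have e : ∀ S : Finset (Fin n), S.inf (fun j => g ⁻¹ᵁ U j) ≤ g ⁻¹ᵁ S.inf U := fun S x hx =>
    (mem_finset_inf_opens (x := g x)).2 (mem_finset_inf_opens.1 hx :)
  refine ⟨fun j => g ⁻¹ᵁ U j, ?_, fun S α =>
    (g.appLE _ _ (e S)).hom (blowupCoefficient f hf hI hfI hh S α), ?_, ?_, ?_⟩
  · refine top_le_iff.1 fun y _ => ?_
    obtain ⟨j, hj⟩ := exists_notMem_asHomogeneousIdeal (N := n + k - 1) (by omega) f hJ hfI (g y)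
    exact Opens.mem_iSup.2 ⟨j, hj⟩
  · beta_reduce
    rw [blowupCoefficient_empty f hk]
    exact algebraToSections_comp _ _ _ _
  · intro α hα
    beta_reduce
    rw [blowupCoefficient, dif_neg fun h => hα (Finsupp.support_eq_empty.1
      (Finset.subset_empty.1 h.2)), map_zero]
  · intro S j hj α hα
    have h1 := congrArg (g.appLE _ _ (e (insert j S))).hom
      (mul_blowupCoefficient_insert f hf hI hfI hh S j hj α hα)
    rw [map_mul, algebraToSections_comp, map_add, apply_ite (g.appLE _ _ (e (insert j S))).hom,
      map_zero, ← CommRingCat.comp_apply, Scheme.Hom.map_appLE] at h1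
    rw [h1, ← CommRingCat.comp_apply, Scheme.Hom.appLE_map]

end Coefficients

/-! ### The sheafified augmented Čech chain complex and its acyclicity. -/

section CoverComplex

open AlgebraicGeometry CategoryTheory Opposite TopologicalSpace

variable (R : Type u) [CommRing R] {n : ℕ} {Y : TopCat.{u}}

instance sheafLinear : Linear R (TopCat.Sheaf (ModuleCat.{u} R) Y) :=
  Linear.fullSubcategory _

/-- The sets `S` with `i = - |S|` such that `W` is contained in `V j` for all `j ∈ S`. -/
def coverSimplices (V : Fin n → Opens Y) (i : ℤ) (W : Opens Y) : Set (Finset (Fin n)) :=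
  {S | (S.card : ℤ) = -i ∧ ∀ j ∈ S, W ≤ V j}

theorem coverSimplices_anti (V : Fin n → Opens Y) (i : ℤ) {W W' : Opens Y} (h : W' ≤ W) :
    coverSimplices V i W ⊆ coverSimplices V i W' :=
  fun _ hS => ⟨hS.1, fun j hj => h.trans (hS.2 j hj)⟩

/-- The free presheaf of modules on `coverSimplices V i`. -/
noncomputable def coverPresheaf (V : Fin n → Opens Y) (i : ℤ) :
    (Opens Y)ᵒᵖ ⥤ ModuleCat.{u} R where
  obj W := ModuleCat.of R (Finsupp.supported R R (coverSimplices V i W.unop))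
  map {W W'} h := ModuleCat.ofHom (Submodule.inclusion
    (Finsupp.supported_mono (coverSimplices_anti V i h.unop.le)))

variable {R}

theorem simplexBoundary_mem (V : Fin n → Opens Y) {i j : ℤ} (hij : i + 1 = j) (W : Opens Y)
    (x : Finset (Fin n) →₀ R) (hx : x ∈ Finsupp.supported R R (coverSimplices V i W)) :
    simplexBoundary R n x ∈ Finsupp.supported R R (coverSimplices V j W) := by
  rw [Finsupp.supported_eq_span_single] at hx
  refine Submodule.span_induction (p := fun x _ => simplexBoundary R n x ∈ _) ?_ (by simp)
    (fun a b _ _ ha hb => by rw [map_add]; exact add_mem ha hb)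
    (fun c a _ ha => by rw [map_smul]; exact Submodule.smul_mem _ _ ha) hx
  rintro _ ⟨S, hS, rfl⟩
  rw [simplexBoundary_single]
  refine Submodule.sum_mem _ fun a ha => Submodule.smul_mem _ _ (Finsupp.single_mem_supported _ _ ?_)
  refine ⟨?_, fun b hb => hS.2 b (Finset.mem_of_mem_erase hb)⟩
  have h1 := Finset.card_erase_add_one ha
  have h2 := hS.1
  omega

theorem simplexHomotopy_mem (V : Fin n → Opens Y) {i j : ℤ} (hij : i + 1 = j) (W : Opens Y)
    (a : Fin n) (ha : W ≤ V a)
    (x : Finset (Fin n) →₀ R) (hx : x ∈ Finsupp.supported R R (coverSimplices V j W)) :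
    simplexHomotopy R a x ∈ Finsupp.supported R R (coverSimplices V i W) := by
  rw [Finsupp.supported_eq_span_single] at hx
  refine Submodule.span_induction (p := fun x _ => simplexHomotopy R a x ∈ _) ?_ (by simp)
    (fun a b _ _ ha hb => by rw [map_add]; exact add_mem ha hb)
    (fun c a _ ha => by rw [map_smul]; exact Submodule.smul_mem _ _ ha) hx
  rintro _ ⟨S, hS, rfl⟩
  rw [simplexHomotopy_single]
  split_ifs with haS
  · exact zero_mem _
  refine Submodule.smul_mem _ _ (Finsupp.single_mem_supported _ _ ?_)
  refine ⟨?_, fun b hb => ?_⟩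
  · have h1 := Finset.card_insert_of_notMem haS
    have h2 := hS.1
    omega
  · rcases Finset.mem_insert.1 hb with rfl | hb
    · exact ha
    · exact hS.2 b hb

variable (R) in
/-- The differential of the complex of presheaves `coverPresheaf R V i`. -/
noncomputable def coverBoundary (V : Fin n → Opens Y) {i j : ℤ} (hij : i + 1 = j) :
    coverPresheaf R V i ⟶ coverPresheaf R V j where
  app W := ModuleCat.ofHom ((simplexBoundary R n).restrict (simplexBoundary_mem V hij W.unop))

variable (R) in
/-- The augmented Čech chain complex of presheaves attached to the family `V`. Its sheafification is
acyclic if the `V j` cover `Y`. -/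
noncomputable def coverComplex (V : Fin n → Opens Y) :
    CochainComplex ((Opens Y)ᵒᵖ ⥤ ModuleCat.{u} R) ℤ where
  X := coverPresheaf R V
  d i j := if hij : i + 1 = j then coverBoundary R V hij else 0
  shape _ _ h := dif_neg h
  d_comp_d' i j k hij hjk := by
    have hij' : i + 1 = j := hij
    have hjk' : j + 1 = k := hjk
    rw [dif_pos hij', dif_pos hjk']
    refine NatTrans.ext (funext fun W => ModuleCat.hom_ext (LinearMap.ext fun x => ?_))
    exact Subtype.ext (simplexBoundary_simplexBoundary _)

theorem coverComplex_d (V : Fin n → Opens Y) {i j : ℤ} (hij : i + 1 = j) :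
    (coverComplex R V).d i j = coverBoundary R V hij := dif_pos hij

/-- Over W ≤ V a, adding a to a simplex gives a simplex over W again, so the cone contraction to a
is available. -/
theorem coverComplex_evaluation_exact (V : Fin n → Opens Y) (i : ℤ) (W : Opens Y) (a : Fin n)
    (ha : W ≤ V a) :
    (((coverComplex R V).sc' (i - 1) i (i + 1)).map ((evaluation _ _).obj (op W))).Exact := by
  rw [ShortComplex.moduleCat_exact_iff]
  intro x hx
  have hx' : simplexBoundary R n x.1 = 0 := by
    have h1 : ((coverBoundary R V (i := i) rfl).app (op W)).hom x = 0 := by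
      rw [← coverComplex_d]; exact hx
    exact congrArg Subtype.val h1
  refine ⟨⟨simplexHomotopy R a x.1, simplexHomotopy_mem V (by omega) W a ha _ x.2⟩, ?_⟩
  have h2 := simplexBoundary_simplexHomotopy_add a x.1
  rw [hx', map_zero, add_zero] at h2
  have h3 : ((coverBoundary R V (i := i - 1) (j := i) (by omega)).app (op W)).hom
      ⟨simplexHomotopy R a x.1, simplexHomotopy_mem V (by omega) W a ha _ x.2⟩ = x :=
    Subtype.ext h2
  rw [← coverComplex_d] at h3
  exact h3

theorem presheaf_hom_eq_zero {V : Fin n → Opens Y} (hV : ⨆ j, V j = ⊤)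
    {P : (Opens Y)ᵒᵖ ⥤ ModuleCat.{u} R} {G : TopCat.Sheaf (ModuleCat.{u} R) Y}
    (f : P ⟶ G.obj) (hf : ∀ (a : Fin n) (W : Opens Y), W ≤ V a → f.app (op W) = 0) : f = 0 := by
  refine NatTrans.ext (funext fun W => ModuleCat.hom_ext (LinearMap.ext fun x => ?_))
  refine TopCat.Sheaf.eq_of_locally_eq' (ι := ULift.{u} (Fin n)) G (fun j => W.unop ⊓ V j.down) W.unop
    (fun j => homOfLE inf_le_left) ?_ _ _ ?_
  · intro y hy
    obtain ⟨j, hj⟩ := Opens.mem_iSup.1 (hV ▸ trivial : y ∈ ⨆ j, V j)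
    exact Opens.mem_iSup.2 ⟨⟨j⟩, hy, hj⟩
  · intro j
    have h1 := f.naturality (homOfLE (inf_le_left : W.unop ⊓ V j.down ≤ W.unop)).op
    rw [hf j.down _ inf_le_right, Limits.comp_zero] at h1
    have h2 := congrArg (fun g => g.hom x) h1
    refine h2.symm.trans ?_
    simp

theorem isZero_presheafToSheaf {V : Fin n → Opens Y} (hV : ⨆ j, V j = ⊤)
    {P : (Opens Y)ᵒᵖ ⥤ ModuleCat.{u} R}
    (hP : ∀ (a : Fin n) (W : Opens Y), W ≤ V a → Limits.IsZero (P.obj (op W))) :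
    Limits.IsZero ((presheafToSheaf (Opens.grothendieckTopology Y) (ModuleCat.{u} R)).obj P) := by
  refine (Limits.IsZero.iff_id_eq_zero _).2 ?_
  have h (f : P ⟶ ((presheafToSheaf (Opens.grothendieckTopology Y)
      (ModuleCat.{u} R)).obj P).obj) : f = 0 :=
    presheaf_hom_eq_zero hV f fun a W h => (hP a W h).eq_of_src _ 0
  exact ((sheafificationAdjunction _ _).homEquiv _ _).injective ((h _).trans (h _).symm)

/-- Sheafification and evaluation commute with homology. The homology presheaf vanishes on all opens
contained in a member of the cover, so its sheafification is zero. -/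
theorem exact_map_presheafToSheaf {V : Fin n → Opens Y} (hV : ⨆ j, V j = ⊤)
    (K : ShortComplex ((Opens Y)ᵒᵖ ⥤ ModuleCat.{u} R))
    (hK : ∀ (a : Fin n) (W : Opens Y), W ≤ V a → (K.map ((evaluation _ _).obj (op W))).Exact) :
    (K.map (presheafToSheaf (Opens.grothendieckTopology Y) (ModuleCat.{u} R))).Exact := by
  rw [ShortComplex.exact_iff_isZero_homology]
  refine Limits.IsZero.of_iso ?_ (K.mapHomologyIso _)
  refine isZero_presheafToSheaf hV fun a W h => ?_
  have h1 := (ShortComplex.exact_iff_isZero_homology _).1 (hK a W h)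
  exact Limits.IsZero.of_iso h1 (K.mapHomologyIso ((evaluation _ _).obj (op W))).symm

variable (R) in
/-- The sheafification of `coverComplex R V`. -/
noncomputable def coverSheafComplex (V : Fin n → Opens Y) :
    CochainComplex (TopCat.Sheaf (ModuleCat.{u} R) Y) ℤ :=
  ((presheafToSheaf (Opens.grothendieckTopology Y) (ModuleCat.{u} R)).mapHomologicalComplex
    (ComplexShape.up ℤ)).obj (coverComplex R V)

theorem coverSheafComplex_acyclic {V : Fin n → Opens Y} (hV : ⨆ j, V j = ⊤) :
    (coverSheafComplex R V).Acyclic := by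
  intro i
  rw [HomologicalComplex.exactAt_iff' _ (i - 1) i (i + 1) (by simp) (by simp)]
  exact exact_map_presheafToSheaf hV _ fun a W h => coverComplex_evaluation_exact V i W a h

end CoverComplex

/-! ### Complexes of homomorphisms as complexes of R-modules. -/

section HomComplex

open CategoryTheory CochainComplex CochainComplex.HomComplex

variable (R : Type u) [CommRing R] {C : Type*} [Category.{u} C] [Preadditive C] [Linear R C]

/-- The complex of homomorphisms of two complexes in an `R`-linear category, as a complex of
`R`-modules. -/
noncomputable def linearHomComplex (K L : CochainComplex C ℤ) :
    CochainComplex (ModuleCat.{u} R) ℤ where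
  X m := ModuleCat.of R (Cochain K L m)
  d i j := ModuleCat.ofHom (δ_hom R K L i j)
  shape _ _ h := ModuleCat.hom_ext (LinearMap.ext fun z => δ_shape _ _ h z)
  d_comp_d' _ _ _ _ _ := ModuleCat.hom_ext (LinearMap.ext fun z => δ_δ _ _ _ z)

/-- `Cochain.single` as a linear map. -/
noncomputable def singleCochain {K L : CochainComplex C ℤ} (p q m : ℤ) :
    (K.X p ⟶ L.X q) →ₗ[R] Cochain K L m where
  toFun f := Cochain.single f m
  map_add' f g := by
    ext p' q' h
    by_cases hp : p' = p
    · by_cases hq : q' = q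
      · subst hp hq
        simp
      · simp [Cochain.single_v_eq_zero' _ _ _ _ _ hq]
    · simp [Cochain.single_v_eq_zero _ _ _ _ _ hp]
  map_smul' r f := by
    ext p' q' h
    by_cases hp : p' = p
    · by_cases hq : q' = q
      · subst hp hq
        simp
      · simp [Cochain.single_v_eq_zero' _ _ _ _ _ hq]
    · simp [Cochain.single_v_eq_zero _ _ _ _ _ hp]

end HomComplex

section HomComplexAcyclic

open CategoryTheory CochainComplex CochainComplex.HomComplex

/-- A cocycle of any degree from an acyclic complex to a K-injective one is a coboundary. -/
theorem linearHomComplex_acyclic (R : Type u) [CommRing R] {C : Type*} [Category.{u} C] [Abelian C]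
    [Linear R C] {K L : CochainComplex C ℤ} (hK : K.Acyclic) [L.IsKInjective] :
    (linearHomComplex R K L).Acyclic := by
  intro i
  rw [HomologicalComplex.exactAt_iff' _ (i - 1) i (i + 1) (by simp) (by simp),
    ShortComplex.moduleCat_exact_iff]
  intro z hz
  obtain ⟨α, hα⟩ := IsKInjective.eq_δ_of_cocycle (Cocycle.mk (z : Cochain K L i) (i + 1) rfl hz) hK
    (i - 1) (by simp)
  exact ⟨α, hα⟩

end HomComplexAcyclic

/-! ### Sections on intersections of the cover as maps out of the Čech presheaves. -/

section CoverSection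

open AlgebraicGeometry CategoryTheory Opposite TopologicalSpace

variable {R : Type u} [CommRing R] {n : ℕ}

theorem coverPresheaf_apply_eq_zero {Y : TopCat.{u}} {V : Fin n → Opens Y} {i : ℤ} {W : Opens Y}
    (x : Finsupp.supported R R (coverSimplices V i W)) {S : Finset (Fin n)} (hS : ¬ W ≤ S.inf V) :
    x.1 S = 0 := by
  by_contra h
  exact hS (Finset.le_inf ((x.2 (Finsupp.mem_support_iff.2 h)).2))

variable {Y : Scheme.{u}} (π : Y ⟶ Spec (CommRingCat.of R)) (V : Fin n → Y.Opens)

open Classical in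
/-- The component of `coverSection` at an open subset. -/
noncomputable def coverSectionApp (i : ℤ) (S : Finset (Fin n)) (s : sectionsObj π (S.inf V))
    (W : Y.Opens) : Finsupp.supported R R (coverSimplices V i W) →ₗ[R] sectionsObj π W :=
  if h : W ≤ S.inf V then
    (Finsupp.lapply S ∘ₗ Submodule.subtype _).smulRight ((sectionsRestrict π (homOfLE h)).hom s)
  else 0

theorem coverSectionApp_apply {i : ℤ} {S : Finset (Fin n)} (s : sectionsObj π (S.inf V))
    {W : Y.Opens} (h : W ≤ S.inf V) (x : Finsupp.supported R R (coverSimplices V i W)) :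
    coverSectionApp π V i S s W x = x.1 S • (sectionsRestrict π (homOfLE h)).hom s := by
  rw [coverSectionApp, dif_pos h]
  rfl

theorem coverSectionApp_of_not_le {i : ℤ} {S : Finset (Fin n)} (s : sectionsObj π (S.inf V))
    {W : Y.Opens} (h : ¬ W ≤ S.inf V) :
    coverSectionApp π V i S s W = 0 := by
  rw [coverSectionApp, dif_neg h]

theorem sectionsRestrict_sectionsRestrict {U V W : Y.Opens} (i : U ⟶ V) (j : V ⟶ W)
    (s : sectionsObj π W) : (sectionsRestrict π i).hom ((sectionsRestrict π j).hom s) =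
      (sectionsRestrict π (i ≫ j)).hom s :=
  congrArg (fun g => g.hom s) ((structurePresheaf π).map_comp j.op i.op).symm

theorem coverSectionApp_naturality {i : ℤ} {S : Finset (Fin n)} (s : sectionsObj π (S.inf V))
    {W W' : Y.Opens} (f : W' ⟶ W) (x : Finsupp.supported R R (coverSimplices V i W)) :
    coverSectionApp π V i S s W' (Submodule.inclusion
      (Finsupp.supported_mono (coverSimplices_anti V i f.le)) x) =
        (sectionsRestrict π f).hom (coverSectionApp π V i S s W x) := by
  by_cases h : W ≤ S.inf V
  · rw [coverSectionApp_apply π V s h, coverSectionApp_apply π V s (f.le.trans h),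
      map_smul, sectionsRestrict_sectionsRestrict]
    rfl
  · rw [coverSectionApp_of_not_le π V s h, LinearMap.zero_apply, map_zero]
    -- When only W' lies in the intersection, S is not a simplex over W, so the coefficient of x at
    -- S is zero.
    by_cases h' : W' ≤ S.inf V
    · rw [coverSectionApp_apply π V s h']
      exact (congrArg (· • _) (coverPresheaf_apply_eq_zero x h)).trans (zero_smul _ _)
    · rw [coverSectionApp_of_not_le π V s h', LinearMap.zero_apply]

theorem coverSectionApp_add (i : ℤ) {S : Finset (Fin n)} (s t : sectionsObj π (S.inf V))
    (W : Y.Opens) : coverSectionApp π V i S (s + t) W =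
      coverSectionApp π V i S s W + coverSectionApp π V i S t W := by
  refine LinearMap.ext fun x => ?_
  by_cases h : W ≤ S.inf V
  · rw [LinearMap.add_apply, coverSectionApp_apply π V _ h, coverSectionApp_apply π V _ h,
      coverSectionApp_apply π V _ h, map_add, smul_add]
  · rw [coverSectionApp_of_not_le π V _ h, coverSectionApp_of_not_le π V _ h,
      coverSectionApp_of_not_le π V _ h, add_zero]

theorem coverSectionApp_smul (i : ℤ) {S : Finset (Fin n)} (r : R) (s : sectionsObj π (S.inf V))
    (W : Y.Opens) : coverSectionApp π V i S (r • s) W = r • coverSectionApp π V i S s W := by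
  refine LinearMap.ext fun x => ?_
  by_cases h : W ≤ S.inf V
  · rw [LinearMap.smul_apply, coverSectionApp_apply π V _ h, coverSectionApp_apply π V _ h,
      map_smul, smul_comm]
  · rw [coverSectionApp_of_not_le π V _ h, coverSectionApp_of_not_le π V _ h, smul_zero]

/-- Restriction from an intersection of members of a cover to a smaller one. -/
noncomputable def restrictInsert (S : Finset (Fin n)) (j : Fin n) :
    sectionsObj π (S.inf V) →ₗ[R] sectionsObj π ((insert j S).inf V) :=
  (sectionsRestrict π (homOfLE (Finset.inf_mono (Finset.subset_insert j S)))).hom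

/-- Dualising the simplicial boundary yields the Čech differential: the section on S is spread over
all S ∪ a by restriction. -/
theorem coverSectionApp_boundary {i j : ℤ} (hij : i + 1 = j) (S : Finset (Fin n))
    (s : sectionsObj π (S.inf V)) (W : Y.Opens)
    (x : Finsupp.supported R R (coverSimplices V i W)) :
    coverSectionApp π V j S s W
        ((simplexBoundary R n).restrict (simplexBoundary_mem V hij W) x) =
      ∑ a ∈ Sᶜ, koszulSign R a (insert a S) •
        coverSectionApp π V i (insert a S) (restrictInsert π V S a s) W x := by
  by_cases h : W ≤ S.inf V
  · rw [coverSectionApp_apply π V s h, LinearMap.coe_restrict_apply, simplexBoundary_apply,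
      Finset.sum_smul]
    refine Finset.sum_congr rfl fun a ha => ?_
    by_cases h' : W ≤ (insert a S).inf V
    · rw [coverSectionApp_apply π V _ h', restrictInsert, sectionsRestrict_sectionsRestrict,
        mul_smul]
      rfl
    · rw [coverSectionApp_of_not_le π V _ h', LinearMap.zero_apply, smul_zero,
        coverPresheaf_apply_eq_zero x h', mul_zero, zero_smul]
  · rw [coverSectionApp_of_not_le π V s h, LinearMap.zero_apply, Finset.sum_eq_zero]
    intro a _
    rw [coverSectionApp_of_not_le π V _
      (fun h' => h (h'.trans (Finset.inf_mono (Finset.subset_insert a S)))),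
      LinearMap.zero_apply, smul_zero]

/-- `coverSectionApp` as a morphism of modules. -/
noncomputable def coverSectionHom (i : ℤ) (S : Finset (Fin n)) (s : sectionsObj π (S.inf V))
    (W : Y.Opens) : ModuleCat.of R (Finsupp.supported R R (coverSimplices V i W)) ⟶
      ModuleCat.of R (sectionsObj π W) :=
  ModuleCat.ofHom (coverSectionApp π V i S s W)

/-- The map of presheaves `coverPresheaf R V i ⟶ 𝒪_Y` that sends the basis element `S` to the
section `s` and the other basis elements to zero. -/
noncomputable def coverSection (i : ℤ) (S : Finset (Fin n)) :
    sectionsObj π (S.inf V) →ₗ[R] (coverPresheaf R V i ⟶ structurePresheaf π) where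
  toFun s :=
    { app W := coverSectionHom π V i S s W.unop
      naturality _ _ f := ModuleCat.hom_ext (LinearMap.ext
        (coverSectionApp_naturality π V s f.unop)) }
  map_add' s t := NatTrans.ext (funext fun W =>
    ModuleCat.hom_ext (coverSectionApp_add π V i s t W.unop))
  map_smul' r s := NatTrans.ext (funext fun W =>
    ModuleCat.hom_ext (coverSectionApp_smul π V i r s W.unop))

theorem coverBoundary_comp_coverSection {i j : ℤ} (hij : i + 1 = j) (S : Finset (Fin n))
    (s : sectionsObj π (S.inf V)) :
    coverBoundary R V hij ≫ coverSection π V j S s =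
      ∑ a ∈ Sᶜ, koszulSign R a (insert a S) •
        coverSection π V i (insert a S) (restrictInsert π V S a s) := by
  refine NatTrans.ext (funext fun W => ModuleCat.hom_ext (LinearMap.ext fun x => ?_))
  refine (coverSectionApp_boundary π V hij S s W.unop x).trans ?_
  rw [NatTrans.app_sum, ModuleCat.hom_sum, LinearMap.sum_apply]
  rfl

end CoverSection

/-! ### The linear universal property of sheafification. -/

section Sheafify

open CategoryTheory Opposite TopologicalSpace

variable {R : Type u} [CommRing R] {Y : TopCat.{u}}

variable (R Y) in
/-- Sheafification of presheaves of modules on a topological space. -/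
noncomputable def associatedSheaf :
    ((Opens Y)ᵒᵖ ⥤ ModuleCat.{u} R) ⥤ TopCat.Sheaf (ModuleCat.{u} R) Y :=
  presheafToSheaf (Opens.grothendieckTopology Y) (ModuleCat.{u} R)

/-- The universal property of sheafification. -/
noncomputable def sheafifyEquiv (P : (Opens Y)ᵒᵖ ⥤ ModuleCat.{u} R)
    (G : TopCat.Sheaf (ModuleCat.{u} R) Y) : ((associatedSheaf R Y).obj P ⟶ G) ≃ (P ⟶ G.obj) :=
  (sheafificationAdjunction (Opens.grothendieckTopology Y) (ModuleCat.{u} R)).homEquiv P G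

theorem sheafifyEquiv_apply {P : (Opens Y)ᵒᵖ ⥤ ModuleCat.{u} R}
    {G : TopCat.Sheaf (ModuleCat.{u} R) Y} (f : (associatedSheaf R Y).obj P ⟶ G) :
    sheafifyEquiv P G f = toSheafify (Opens.grothendieckTopology Y) P ≫ f.hom :=
  Adjunction.homEquiv_unit _ _ _ _

theorem sheafifyEquiv_add {P : (Opens Y)ᵒᵖ ⥤ ModuleCat.{u} R}
    {G : TopCat.Sheaf (ModuleCat.{u} R) Y} (f g : (associatedSheaf R Y).obj P ⟶ G) :
    sheafifyEquiv P G (f + g) = sheafifyEquiv P G f + sheafifyEquiv P G g := by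
  rw [sheafifyEquiv_apply, sheafifyEquiv_apply, sheafifyEquiv_apply]
  exact Preadditive.comp_add _ _ _ _ _ _

theorem sheafifyEquiv_smul {P : (Opens Y)ᵒᵖ ⥤ ModuleCat.{u} R}
    {G : TopCat.Sheaf (ModuleCat.{u} R) Y} (r : R) (f : (associatedSheaf R Y).obj P ⟶ G) :
    sheafifyEquiv P G (r • f) = r • sheafifyEquiv P G f := by
  rw [sheafifyEquiv_apply, sheafifyEquiv_apply]
  exact Linear.comp_smul _ _ _ _ _ _

/-- The universal property of sheafification, as a linear map. -/
noncomputable def sheafifyHom (P : (Opens Y)ᵒᵖ ⥤ ModuleCat.{u} R)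
    (G : TopCat.Sheaf (ModuleCat.{u} R) Y) :
    (P ⟶ G.obj) →ₗ[R] ((associatedSheaf R Y).obj P ⟶ G) where
  toFun := (sheafifyEquiv P G).symm
  map_add' f g := (sheafifyEquiv P G).injective (by
    rw [Equiv.apply_symm_apply, sheafifyEquiv_add, Equiv.apply_symm_apply, Equiv.apply_symm_apply])
  map_smul' r f := (sheafifyEquiv P G).injective (by
    rw [Equiv.apply_symm_apply, sheafifyEquiv_smul, Equiv.apply_symm_apply, RingHom.id_apply])

theorem toSheafify_sheafifyHom {P : (Opens Y)ᵒᵖ ⥤ ModuleCat.{u} R}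
    {G : TopCat.Sheaf (ModuleCat.{u} R) Y} (f : P ⟶ G.obj) :
    toSheafify (Opens.grothendieckTopology Y) P ≫ (sheafifyHom P G f).hom = f :=
  (sheafifyEquiv_apply _).symm.trans (Equiv.apply_symm_apply _ _)

theorem map_comp_sheafifyHom {P Q : (Opens Y)ᵒᵖ ⥤ ModuleCat.{u} R}
    {G : TopCat.Sheaf (ModuleCat.{u} R) Y} (h : P ⟶ Q) (f : Q ⟶ G.obj) :
    (associatedSheaf R Y).map h ≫ sheafifyHom Q G f =
      sheafifyHom P G (h ≫ f) :=
  ((sheafificationAdjunction _ _).homEquiv_naturality_left_symm h f).symm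

end Sheafify

/-! ### Čech cochains with values in an injective resolution, and their evaluation in derived
sections. -/

section CoverCochain

open AlgebraicGeometry CategoryTheory Opposite TopologicalSpace CochainComplex.HomComplex

variable {R : Type u} [CommRing R] {n : ℕ} {Y : Scheme.{u}}

/-- The augmentation of an injective resolution. -/
noncomputable def resolutionUnit {F : TopCat.Sheaf (ModuleCat.{u} R) Y}
    (I : InjectiveResolution F) : F ⟶ I.cochainComplex.X 0 :=
  (HomologicalComplex.singleObjXSelf (ComplexShape.up ℤ) 0 F).inv ≫ I.ι'.f 0

theorem resolutionUnit_d {F : TopCat.Sheaf (ModuleCat.{u} R) Y}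
    (I : InjectiveResolution F) (j : ℤ) : resolutionUnit I ≫ I.cochainComplex.d 0 j = 0 := by
  have h1 : I.ι'.f 0 ≫ I.cochainComplex.d 0 j = 0 := by
    rw [I.ι'.comm]
    have : ((CochainComplex.singleFunctor (TopCat.Sheaf (ModuleCat.{u} R) Y) 0).obj F).d 0 j = 0 :=
      HomologicalComplex.single_obj_d _ _ _ _ _
    rw [this, Limits.zero_comp]
  exact (Category.assoc _ _ _).trans ((congrArg (_ ≫ ·) h1).trans Limits.comp_zero)

/-- The complex of homomorphisms from the sheafified augmented Čech complex of the family `V` to an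
injective resolution. -/
noncomputable def coverHomComplex (V : Fin n → Y.Opens) {F : TopCat.Sheaf (ModuleCat.{u} R) Y}
    (I : InjectiveResolution F) : CochainComplex (ModuleCat.{u} R) ℤ :=
  linearHomComplex R (coverSheafComplex R V) I.cochainComplex

theorem coverHomComplex_acyclic {V : Fin n → Y.Opens} (hV : ⨆ j, V j = ⊤)
    {F : TopCat.Sheaf (ModuleCat.{u} R) Y} (I : InjectiveResolution F) :
    (coverHomComplex V I).Acyclic :=
  linearHomComplex_acyclic R (coverSheafComplex_acyclic hV)

/-- The global section of the sheafified Čech complex corresponding to the empty set. -/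
noncomputable def coverUnit (V : Fin n → Y.Opens) :
    (globalSections R Y).obj ((coverSheafComplex R V).X 0) :=
  ((toSheafify (Opens.grothendieckTopology Y) (coverPresheaf R V 0)).app (op ⊤)).hom
    ⟨Finsupp.single ∅ 1, Finsupp.single_mem_supported _ _ ⟨by simp, by simp⟩⟩

/-- The empty simplex has zero boundary. This is what makes evaluation at `coverUnit` a map of
complexes. -/
theorem coverUnit_d (V : Fin n → Y.Opens) (j : ℤ) :
    ((globalSections R Y).map ((coverSheafComplex R V).d 0 j)).hom (coverUnit V) = 0 := by
  by_cases hj : (0 : ℤ) + 1 = j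
  · have h1 : (coverSheafComplex R V).d 0 j = (associatedSheaf R Y).map (coverBoundary R V hj) := by
      rw [← coverComplex_d]; rfl
    rw [h1]
    have h2 := toSheafify_naturality (Opens.grothendieckTopology Y) (coverBoundary R V hj)
    have h3 := congrArg (fun g => (g.app (op ⊤)).hom
      ⟨Finsupp.single ∅ 1, Finsupp.single_mem_supported R _ ⟨by simp, by simp⟩⟩) h2
    refine h3.symm.trans ?_
    have h4 : ((coverBoundary R V hj).app (op ⊤)).hom
      ⟨Finsupp.single ∅ 1, Finsupp.single_mem_supported R _ ⟨by simp, by simp⟩⟩ = 0 :=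
      Subtype.ext (by
        change simplexBoundary R n (Finsupp.single ∅ 1) = 0
        rw [simplexBoundary_single]; simp)
    exact (congrArg ((toSheafify (Opens.grothendieckTopology Y) (coverPresheaf R V j)).app
      (op ⊤)).hom h4).trans (map_zero _)
  · rw [HomologicalComplex.shape _ _ _ hj, Functor.map_zero]
    rfl

/-- The map from `coverHomComplex` to the derived global sections given by `coverUnit`. -/
noncomputable def coverEvaluation (V : Fin n → Y.Opens) {F : TopCat.Sheaf (ModuleCat.{u} R) Y}
    (I : InjectiveResolution F) : coverHomComplex V I ⟶ derivedSections I where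
  f m := (ModuleCat.ofHom
    { toFun := fun z : Cochain (coverSheafComplex R V) I.cochainComplex m =>
        ((globalSections R Y).map (z.v 0 m (zero_add m))).hom (coverUnit V)
      map_add' := fun _ _ => rfl
      map_smul' := fun _ _ => rfl } : ModuleCat.of R _ ⟶ ModuleCat.of R ((globalSections R Y).obj (I.cochainComplex.X m)))
  comm' i j hij := by
    have hij' : i + 1 = j := hij
    refine ModuleCat.hom_ext (LinearMap.ext fun z => ?_)
    change ((globalSections R Y).map (I.cochainComplex.d i j)).hom
      (((globalSections R Y).map (Cochain.v (n := i) z 0 i (zero_add i))).hom (coverUnit V)) =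
      ((globalSections R Y).map ((δ i j z).v 0 j (zero_add j))).hom (coverUnit V)
    rw [δ_v i j hij' z 0 j (zero_add j) i 1 (by omega) (by omega), Functor.map_add, Functor.map_comp]
    have h1 : (globalSections R Y).map (j.negOnePow • (coverSheafComplex R V).d 0 1 ≫
        Cochain.v (n := i) z 1 j (by omega)) = j.negOnePow • ((globalSections R Y).map
          ((coverSheafComplex R V).d 0 1) ≫ (globalSections R Y).map
          (Cochain.v (n := i) z 1 j (by omega))) := by
      rw [← Functor.map_comp]
      rfl
    rw [h1]
    have h2 : ((globalSections R Y).map ((coverSheafComplex R V).d 0 1) ≫ (globalSections R Y).map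
          (Cochain.v (n := i) z 1 j (by omega))).hom (coverUnit V) = 0 :=
      (congrArg (ModuleCat.Hom.hom ((globalSections R Y).map _)) (coverUnit_d V 1)).trans (map_zero _)
    rw [ModuleCat.hom_add, LinearMap.add_apply]
    have h3 : (j.negOnePow • ((globalSections R Y).map
          ((coverSheafComplex R V).d 0 1) ≫ (globalSections R Y).map
          (Cochain.v (n := i) z 1 j (by omega)))).hom (coverUnit V) = 0 := by
      rw [Units.smul_def, ModuleCat.hom_zsmul, LinearMap.smul_apply, h2, smul_zero]
    rw [h3, add_zero]
    rfl

variable (π : Y ⟶ Spec (CommRingCat.of R)) (V : Fin n → Y.Opens)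
  (I : InjectiveResolution (structureSheaf π))

/-- The Čech cochain of degree `i` with value in the resolution `I` that is `s` on `S` and
zero elsewhere. -/
noncomputable def coverCochain (i : ℤ) (S : Finset (Fin n)) :
    sectionsObj π (S.inf V) →ₗ[R] (coverHomComplex V I).X i :=
  singleCochain R (K := coverSheafComplex R V) (L := I.cochainComplex) (-i) 0 i ∘ₗ
    Linear.rightComp R _ (resolutionUnit I) ∘ₗ
    sheafifyHom (coverPresheaf R V (-i)) (structureSheaf π) ∘ₗ coverSection π V (-i) S

/-- The Hom differential has two parts. The one from the resolution vanishes because the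
augmentation lands in cocycles; the one from the source is the Čech differential, with the sign of
the Hom complex. -/
theorem coverHomComplex_d_coverCochain {i j : ℤ} (hij : i + 1 = j) (S : Finset (Fin n))
    (s : sectionsObj π (S.inf V)) :
    ((coverHomComplex V I).d i j).hom (coverCochain π V I i S s) =
      j.negOnePow • ∑ a ∈ Sᶜ, koszulSign R a (insert a S) •
        coverCochain π V I j (insert a S) (restrictInsert π V S a s) := by
  have hd : (coverSheafComplex R V).d (-j) (-i) ≫ sheafifyHom (coverPresheaf R V (-i))
      (structureSheaf π) (coverSection π V (-i) S s) =
        ∑ a ∈ Sᶜ, koszulSign R a (insert a S) • sheafifyHom (coverPresheaf R V (-j))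
          (structureSheaf π) (coverSection π V (-j) (insert a S) (restrictInsert π V S a s)) := by
    have h1 : (coverSheafComplex R V).d (-j) (-i) = (associatedSheaf R Y).map
        (coverBoundary R V (show -j + 1 = -i by omega)) := by
      rw [← coverComplex_d]; rfl
    rw [h1]
    refine (map_comp_sheafifyHom _ _).trans ?_
    refine (congrArg (sheafifyHom (coverPresheaf R V (-j)) (structureSheaf π))
      (coverBoundary_comp_coverSection π V _ S s)).trans ((map_sum _ _ _).trans ?_)
    exact Finset.sum_congr rfl fun a _ => map_smul _ _ _
  refine (Cochain.δ_single _ i j hij (-j) 1 (by omega) (by omega)).trans ?_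
  have h2 : (sheafifyHom (coverPresheaf R V (-i)) (structureSheaf π) (coverSection π V (-i) S s) ≫
      resolutionUnit I) ≫ I.cochainComplex.d 0 1 = 0 := by
    rw [Category.assoc, resolutionUnit_d, Limits.comp_zero]
  have h3 : (coverSheafComplex R V).d (-j) (-i) ≫ (sheafifyHom (coverPresheaf R V (-i))
      (structureSheaf π) (coverSection π V (-i) S s) ≫ resolutionUnit I) =
        ∑ a ∈ Sᶜ, koszulSign R a (insert a S) • (sheafifyHom (coverPresheaf R V (-j))
          (structureSheaf π) (coverSection π V (-j) (insert a S) (restrictInsert π V S a s)) ≫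
            resolutionUnit I) := by
    refine (Category.assoc _ _ _).symm.trans ((congrArg (· ≫ resolutionUnit I) hd).trans ?_)
    exact (Preadditive.sum_comp _ _ _).trans (Finset.sum_congr rfl fun a _ =>
      Linear.smul_comp _ _ _ _ _ _)
  refine (congrArg₂ (· + ·) ((congrArg (Cochain.single · j) h2).trans (Cochain.single_zero _ _ _ _ _))
    (congrArg (fun g => j.negOnePow • singleCochain R (K := coverSheafComplex R V)
      (L := I.cochainComplex) (-j) 0 j g) h3)).trans ?_
  refine (zero_add _).trans (congrArg (j.negOnePow • ·) ?_)
  exact (map_sum _ _ _).trans (Finset.sum_congr rfl fun a _ => map_smul _ _ _)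

/-- The cochain is concentrated on the source term of degree -i, whereas evaluation only sees the
source term of degree 0. -/
theorem coverEvaluation_coverCochain_of_ne {i : ℤ} (hi : i ≠ 0) (S : Finset (Fin n))
    (s : sectionsObj π (S.inf V)) :
    ((coverEvaluation V I).f i).hom (coverCochain π V I i S s) = 0 := by
  have h : (coverCochain π V I i S s : Cochain (coverSheafComplex R V) I.cochainComplex i).v 0 i
      (zero_add i) = 0 := Cochain.single_v_eq_zero' _ _ _ _ _ hi
  change ((globalSections R Y).map (Cochain.v (n := i) (coverCochain π V I i S s) 0 i
    (zero_add i))).hom (coverUnit V) = 0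
  rw [h, Functor.map_zero]
  rfl

theorem iso_inv_comp_conj_comp {C : Type*} [Category* C] {A B A' B' D D' : C} (e : A ≅ B)
    (e' : A' ≅ B') (u : B ⟶ B') (v : B' ⟶ D) (w : D ⟶ D') :
    e.inv ≫ (e.hom ≫ u ≫ e'.inv) ≫ (e'.hom ≫ v) ≫ w = u ≫ v ≫ w := by simp

theorem singleObjXSelf_inv_comp_derivedSectionsUnit :
    (HomologicalComplex.singleObjXSelf (.up ℤ) 0 (ModuleCat.of R R)).inv ≫
      (derivedSectionsUnit π I).f 0 = unitSection π ≫ (globalSections R Y).map (resolutionUnit I) := by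
  have h1 : (derivedSectionsUnit π I).f 0 =
      ((HomologicalComplex.single _ _ 0).map (unitSection π)).f 0 ≫
      ((HomologicalComplex.singleMapHomologicalComplex (globalSections R Y)
        (ComplexShape.up ℤ) 0).inv.app (structureSheaf π)).f 0 ≫
      (globalSections R Y).map (I.ι'.f 0) := rfl
  have h2 : (globalSections R Y).map (resolutionUnit I) = (globalSections R Y).map
    (HomologicalComplex.singleObjXSelf (ComplexShape.up ℤ) 0 (structureSheaf π)).inv ≫
      (globalSections R Y).map (I.ι'.f 0) := Functor.map_comp _ _ _
  rw [h1, h2, HomologicalComplex.single_map_f_self,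
    HomologicalComplex.singleMapHomologicalComplex_inv_app_self]
  exact iso_inv_comp_conj_comp _ _ _ _ _

theorem globalSections_map_sheafifyHom_coverUnit (s : sectionsObj π (Finset.inf ∅ V)) :
    ((globalSections R Y).map (sheafifyHom (coverPresheaf R V 0) (structureSheaf π)
      (coverSection π V 0 ∅ s))).hom (coverUnit V) = s := by
  have h1 := congrArg (fun g => (g.app (op ⊤)).hom
    (⟨Finsupp.single ∅ 1, Finsupp.single_mem_supported _ _ ⟨by simp, by simp⟩⟩ :
      Finsupp.supported R R (coverSimplices V 0 ⊤)))
    (toSheafify_sheafifyHom (G := structureSheaf π) (coverSection π V 0 ∅ s))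
  refine Eq.trans h1 ?_
  change coverSectionApp π V 0 ∅ s ⊤ _ = s
  rw [coverSectionApp_apply π V s (by simp), Finsupp.single_eq_same, one_smul]
  exact congrArg (fun g => g.hom s) ((structurePresheaf π).map_id (op ⊤))

theorem coverEvaluation_coverCochain_zero (h : R) :
    ((coverEvaluation V I).f 0).hom (coverCochain π V I 0 ∅ (algebraToSections π _ h)) =
      ((derivedSectionsUnit π I).f 0).hom
        ((HomologicalComplex.singleObjXSelf (.up ℤ) 0 (ModuleCat.of R R)).inv.hom h) := by
  have h1 := congrArg (fun g => g.hom h) (singleObjXSelf_inv_comp_derivedSectionsUnit π I)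
  refine Eq.trans ?_ h1.symm
  have h2 : (coverCochain π V I 0 ∅ (algebraToSections π _ h) :
      Cochain (coverSheafComplex R V) I.cochainComplex 0).v 0 0 (zero_add 0) =
      sheafifyHom (coverPresheaf R V 0) (structureSheaf π)
        (coverSection π V 0 ∅ (algebraToSections π _ h)) ≫ resolutionUnit I :=
    Cochain.single_v (K := coverSheafComplex R V) (L := I.cochainComplex) (p := 0) (q := 0) _ 0 _
  change ((globalSections R Y).map (Cochain.v (n := 0) (coverCochain π V I 0 ∅
    (algebraToSections π _ h)) 0 0 (zero_add 0))).hom (coverUnit V) = _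
  rw [h2]
  refine congrArg ((globalSections R Y).map (resolutionUnit I)).hom
    ((globalSections_map_sheafifyHom_coverUnit π V _).trans ?_)
  exact (mul_one (algebraToSections π ⊤ h)).symm

end CoverCochain

/-! ### Elements of total tensor products and the Leibniz rule. -/

section TensorElements

open CategoryTheory HomologicalComplex TensorProduct
open MonoidalCategory hiding tensorObj tensorHom rightUnitor tensorUnit

variable {R : Type u} [CommRing R] (K L : CochainComplex (ModuleCat.{u} R) ℤ)

/-- The element `x ⊗ y` of the total tensor product of two complexes. -/
noncomputable def tensorElement (i j m : ℤ) (h : i + j = m) :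
    K.X i →ₗ[R] L.X j →ₗ[R] (tensorObj K L).X m :=
  (TensorProduct.mk R (K.X i) (L.X j)).compr₂ (ιTensorObj K L i j m h).hom

theorem d_tensorElement {i j m i' j' m' : ℤ} (h : i + j = m) (hm : m + 1 = m')
    (hi : i + 1 = i') (hj : j + 1 = j') (x : K.X i) (y : L.X j) :
    ((tensorObj K L).d m m').hom (tensorElement K L i j m h x y) =
      tensorElement K L i' j m' (by omega) ((K.d i i').hom x) y +
      i.negOnePow • tensorElement K L i j' m' (by omega) x ((L.d j j').hom y) := by
  have h1 : ιTensorObj K L i j m h ≫ (tensorObj K L).d m m' =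
      (K.d i i' ▷ L.X j) ≫ ιTensorObj K L i' j m' (by omega) +
      i.negOnePow • ((K.X i ◁ L.d j j') ≫ ιTensorObj K L i j' m' (by omega)) := by
    rw [mapBifunctor.d_eq, Preadditive.comp_add, mapBifunctor.ι_D₁, mapBifunctor.ι_D₂,
      mapBifunctor.d₁_eq K L _ _ (show (ComplexShape.up ℤ).Rel i i' from hi) j m'
        (show i' + j = m' by omega),
      mapBifunctor.d₂_eq K L _ _ i (show (ComplexShape.up ℤ).Rel j j' from hj) m'
        (show i + j' = m' by omega)]
    exact congrArg₂ (· + ·) (one_smul _ _) rfl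
  have h2 := LinearMap.congr_fun (congrArg ModuleCat.Hom.hom h1) (x ⊗ₜ y)
  refine h2.trans ?_
  rw [ModuleCat.hom_add, LinearMap.add_apply, Units.smul_def, ModuleCat.hom_zsmul,
    LinearMap.smul_apply, ← Units.smul_def]
  rfl

variable {K L} in
theorem tensorHom_tensorElement {L' : CochainComplex (ModuleCat.{u} R) ℤ} (φ : L ⟶ L')
    {i j m : ℤ} (h : i + j = m) (x : K.X i) (y : L.X j) :
    ((tensorHom (𝟙 K) φ).f m).hom (tensorElement K L i j m h x y) =
      tensorElement K L' i j m h x ((φ.f j).hom y) := by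
  have h1 := ι_mapBifunctorMap (𝟙 K) φ (curriedTensor (ModuleCat.{u} R)) (ComplexShape.up ℤ) i j m h
  exact LinearMap.congr_fun (congrArg ModuleCat.Hom.hom h1) (x ⊗ₜ y)

theorem rightUnitor_inv_apply (i : ℤ) (x : K.X i) :
    ((rightUnitor K).inv.f i).hom x = tensorElement K (tensorUnit (ModuleCat.{u} R) (ComplexShape.up ℤ)) i 0 i (add_zero i) x
      ((singleObjXSelf (ComplexShape.up ℤ) 0 (ModuleCat.of R R)).inv.hom 1) :=
  LinearMap.congr_fun (congrArg ModuleCat.Hom.hom (rightUnitor'_inv K i)) x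

end TensorElements

/-! ### Reindexing sums over subsets and exponents. -/

section Reindexing

theorem sum_sum_mem_eq_sum_sum_insert {ι M : Type*} [Fintype ι] [DecidableEq ι] [AddCommMonoid M]
    (Φ : Finset ι → ι → M) :
    ∑ S : Finset ι, ∑ j ∈ S, Φ S j = ∑ T : Finset ι, ∑ j ∈ Tᶜ, Φ (insert j T) j := by
  rw [Finset.sum_sigma', Finset.sum_sigma']
  refine Finset.sum_bij' (fun x _ => ⟨x.1.erase x.2, x.2⟩) (fun x _ => ⟨insert x.2 x.1, x.2⟩)
    ?_ ?_ ?_ ?_ ?_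
  · rintro ⟨S, j⟩ h
    simp
  · rintro ⟨S, j⟩ h
    simp
  · rintro ⟨S, j⟩ h
    simp only [Finset.mem_sigma, Finset.mem_univ, true_and] at h
    simp [Finset.insert_erase h]
  · rintro ⟨S, j⟩ h
    simp only [Finset.mem_sigma, Finset.mem_univ, true_and, Finset.mem_compl] at h
    simp [Finset.erase_insert h]
  · rintro ⟨S, j⟩ h
    simp only [Finset.mem_sigma, Finset.mem_univ, true_and] at h
    simp [Finset.insert_erase h]

/-- The exponents of degree less than `k`. -/
noncomputable def exponentsBelow (n k : ℕ) : Finset (Fin n →₀ ℕ) :=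
  (Finsupp.finite_of_degree_le (σ := Fin n) k).toFinset.filter fun α => α.degree < k

theorem mem_exponentsBelow {n k : ℕ} {α : Fin n →₀ ℕ} : α ∈ exponentsBelow n k ↔ α.degree < k := by
  simp only [exponentsBelow, Finset.mem_filter, Set.Finite.mem_toFinset, Set.mem_ofPred_eq]
  exact ⟨fun h => h.2, fun h => ⟨h.le, h⟩⟩

theorem sum_exponentsBelow_shift {n k : ℕ} {M : Type*} [AddCommMonoid M] (j : Fin n)
    (ψ : (Fin n →₀ ℕ) → (Fin n →₀ ℕ) → M) :
    ∑ α ∈ exponentsBelow n k, (if α.degree + 1 < k then ψ α (α + Finsupp.single j 1) else 0) =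
      ∑ β ∈ exponentsBelow n k, (if β j = 0 then 0 else ψ (β - Finsupp.single j 1) β) := by
  rw [← Finset.sum_filter]
  have h : ∀ β : Fin n →₀ ℕ, (if β j = 0 then 0 else ψ (β - Finsupp.single j 1) β) =
      if β j ≠ 0 then ψ (β - Finsupp.single j 1) β else 0 := fun β => by split_ifs <;> simp_all
  rw [Finset.sum_congr rfl fun β _ => h β, ← Finset.sum_filter]
  have key : ∀ β : Fin n →₀ ℕ, β j ≠ 0 → β - Finsupp.single j 1 + Finsupp.single j 1 = β :=
    fun β hβ => tsub_add_cancel_of_le (Finsupp.single_le_iff.2 (Nat.one_le_iff_ne_zero.2 hβ))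
  refine Finset.sum_bij' (fun α _ => α + Finsupp.single j 1) (fun β _ => β - Finsupp.single j 1)
    ?_ ?_ ?_ ?_ ?_
  · intro α h
    simp only [Finset.mem_filter, mem_exponentsBelow] at h ⊢
    refine ⟨by rw [map_add, Finsupp.degree_single]; exact h.2, by simp⟩
  · intro β h
    simp only [Finset.mem_filter, mem_exponentsBelow] at h ⊢
    have h1 := congrArg Finsupp.degree (key β h.2)
    rw [map_add, Finsupp.degree_single] at h1
    omega
  · intro α _
    exact add_tsub_cancel_right _ _
  · intro β h
    exact key β (Finset.mem_filter.1 h).2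
  · intro α _
    rw [add_tsub_cancel_right]

end Reindexing

/-! ### The cycle in the tensor product of the resolution with the Čech–Hom complex. -/

section Cycle

open CategoryTheory HomologicalComplex

variable {R : Type u} [CommRing R] {n k : ℕ} {f : Fin n → R}
  {K E : CochainComplex (ModuleCat.{u} R) ℤ}
  (b : ∀ (p : ℕ) (i : ℤ), i = -p → TwistedKoszul R n →ₗ[R] K.X i)
  {A : Finset (Fin n) → Type u} [∀ S, AddCommGroup (A S)] [∀ S, Module R (A S)]
  (θ : ∀ (i : ℤ) S, A S →ₗ[R] E.X i)

/-- The tensor product of an element of the twisted Koszul complex and of a Čech cochain. -/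
noncomputable def tensorCochain (S : Finset (Fin n)) (p : ℕ) (m : ℤ) :
    TwistedKoszul R n →ₗ[R] A S →ₗ[R] (tensorObj K E).X m :=
  (tensorElement K E (-p) (m + p) m (by omega)).compl₁₂ (b p (-p) rfl) (θ (m + p) S)

variable {b θ}

theorem tensorElement_apply_congr {i j j' m : ℤ} (h : i + j = m) (h' : i + j' = m) (x : K.X i)
    (S : Finset (Fin n)) (s : A S) : tensorElement K E i j m h x (θ j S s) =
      tensorElement K E i j' m h' x (θ j' S s) := by
  obtain rfl : j = j' := by omega
  rfl

theorem tensorElement_d_right {ρ : ∀ S j, A S →ₗ[R] A (insert j S)}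
    (hθ : ∀ i j, i + 1 = j → ∀ S s, (E.d i j).hom (θ i S s) =
      j.negOnePow • ∑ a ∈ Sᶜ, koszulSign R a (insert a S) • θ j (insert a S) (ρ S a s))
    (S : Finset (Fin n)) (p : ℕ) (x : TwistedKoszul R n) (s : A S) :
    (-(p : ℤ)).negOnePow • tensorElement K E (-p) (1 + p) 1 (by omega) (b p (-p) rfl x)
      ((E.d (0 + p) (1 + p)).hom (θ (0 + p) S s)) =
      - ∑ a ∈ Sᶜ, koszulSign R a (insert a S) • tensorCochain b θ (insert a S) p 1 x (ρ S a s) := by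
  -- The Leibniz sign (-1) ^ p and the Hom complex sign (-1) ^ (p + 1) combine to -1 for every p, so
  -- no S-dependent sign is needed in the cycle.
  have hs : (-(p : ℤ)).negOnePow * (1 + (p : ℤ)).negOnePow = -1 := by
    rw [← Int.negOnePow_add, neg_add_cancel_comm_assoc, Int.negOnePow_one]
  rw [hθ _ _ (by omega), Units.smul_def (1 + (p : ℤ)).negOnePow, map_zsmul, ← Units.smul_def,
    smul_smul, hs, Units.neg_smul, one_smul, map_sum]
  congr 1
  exact Finset.sum_congr rfl fun a _ => map_smul _ _ _

theorem d_tensorCochain_succ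
    (hb : ∀ p i j hi hj x, (K.d i j).hom (b (p + 1) i hi x) = b p j hj (twistedBoundary f k x))
    {ρ : ∀ S j, A S →ₗ[R] A (insert j S)}
    (hθ : ∀ i j, i + 1 = j → ∀ S s, (E.d i j).hom (θ i S s) =
      j.negOnePow • ∑ a ∈ Sᶜ, koszulSign R a (insert a S) • θ j (insert a S) (ρ S a s))
    (S : Finset (Fin n)) (p : ℕ) (x : TwistedKoszul R n) (s : A S) :
    ((tensorObj K E).d 0 1).hom (tensorCochain b θ S (p + 1) 0 x s) =
      tensorCochain b θ S p 1 (twistedBoundary f k x) s -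
      ∑ a ∈ Sᶜ, koszulSign R a (insert a S) •
        tensorCochain b θ (insert a S) (p + 1) 1 x (ρ S a s) := by
  refine (d_tensorElement K E (i' := -p) (j' := 1 + ↑(p + 1)) _ (by omega) (by push_cast; omega)
    (by omega) _ _).trans ?_
  rw [sub_eq_add_neg, ← tensorElement_d_right hθ, hb p _ _ _ rfl]
  congr 1
  exact tensorElement_apply_congr _ _ _ _ _

theorem d_tensorCochain_zero
    (hb0 : ∀ j x, (K.d 0 j).hom (b 0 0 rfl x) = 0)
    {ρ : ∀ S j, A S →ₗ[R] A (insert j S)}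
    (hθ : ∀ i j, i + 1 = j → ∀ S s, (E.d i j).hom (θ i S s) =
      j.negOnePow • ∑ a ∈ Sᶜ, koszulSign R a (insert a S) • θ j (insert a S) (ρ S a s))
    (S : Finset (Fin n)) (x : TwistedKoszul R n) (s : A S) :
    ((tensorObj K E).d 0 1).hom (tensorCochain b θ S 0 0 x s) =
      - ∑ a ∈ Sᶜ, koszulSign R a (insert a S) •
        tensorCochain b θ (insert a S) 0 1 x (ρ S a s) := by
  refine (d_tensorElement K E (i' := 1) (j' := 1 + ↑(0 : ℕ)) _ (by omega) (by simp)
    (by omega) _ _).trans ?_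
  rw [← tensorElement_d_right hθ]
  refine (congrArg (· + _) ?_).trans (zero_add _)
  have h : (K.d (-((0 : ℕ) : ℤ)) 1).hom (b 0 (-((0 : ℕ) : ℤ)) rfl x) = 0 := hb0 1 x
  rw [h, map_zero, LinearMap.zero_apply]

/-- Merges the cases S = ∅, where the Koszul part is an empty sum, and S ≠ ∅ into one formula that
can be summed over all S. -/
theorem d_tensorCochain_card
    (hb : ∀ p i j hi hj x, (K.d i j).hom (b (p + 1) i hi x) = b p j hj (twistedBoundary f k x))
    (hb0 : ∀ j x, (K.d 0 j).hom (b 0 0 rfl x) = 0)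
    {ρ : ∀ S j, A S →ₗ[R] A (insert j S)}
    (hθ : ∀ i j, i + 1 = j → ∀ S s, (E.d i j).hom (θ i S s) =
      j.negOnePow • ∑ a ∈ Sᶜ, koszulSign R a (insert a S) • θ j (insert a S) (ρ S a s))
    (S : Finset (Fin n)) (α : Fin n →₀ ℕ) (s : A S) :
    ((tensorObj K E).d 0 1).hom (tensorCochain b θ S S.card 0 (Finsupp.single (S, α) 1) s) =
      ∑ j ∈ S, koszulSign R j S • tensorCochain b θ S (S.erase j).card 1
          (truncMul f k j (Finsupp.single (S.erase j, α) 1)) s -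
      ∑ a ∈ Sᶜ, koszulSign R a (insert a S) •
        tensorCochain b θ (insert a S) S.card 1 (Finsupp.single (S, α) 1) (ρ S a s) := by
  obtain hS | ⟨p, hp⟩ : S.card = 0 ∨ ∃ p, S.card = p + 1 := by
    rcases Nat.eq_zero_or_pos S.card with h | h
    · exact Or.inl h
    · exact Or.inr ⟨S.card - 1, by omega⟩
  · rw [hS, d_tensorCochain_zero hb0 hθ, Finset.sum_eq_zero (s := S), zero_sub]
    intro j hj
    rw [Finset.card_eq_zero.1 hS] at hj
    exact absurd hj (Finset.notMem_empty j)
  · rw [hp, d_tensorCochain_succ hb hθ, twistedBoundary_single, map_sum, LinearMap.sum_apply]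
    congr 1
    refine Finset.sum_congr rfl fun j hj => ?_
    rw [map_smul, LinearMap.smul_apply, show (S.erase j).card = p by
      rw [Finset.card_erase_of_mem hj, hp]; rfl]

/-- The recursion for f j • a (insert j T) α produces the wanted term and a shifted coefficient.
After reindexing the exponents, the shifted coefficients cancel the truncated multiplications by X j
on the other factor. -/
theorem sum_tensorCochain_truncMul {ρ : ∀ S j, A S →ₗ[R] A (insert j S)}
    {a : ∀ S, (Fin n →₀ ℕ) → A S}
    (ha : ∀ (S : Finset (Fin n)) (j : Fin n), j ∉ S → ∀ α : Fin n →₀ ℕ, α.degree < k →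
      f j • a (insert j S) α =
        ρ S j (a S α) + if α j = 0 then 0 else a (insert j S) (α - Finsupp.single j 1))
    {T : Finset (Fin n)} {j : Fin n} (hj : j ∉ T) (p : ℕ) (m : ℤ) :
    ∑ α ∈ exponentsBelow n k, tensorCochain b θ (insert j T) p m
        (truncMul f k j (Finsupp.single (T, α) 1)) (a (insert j T) α) =
      ∑ α ∈ exponentsBelow n k, tensorCochain b θ (insert j T) p m (Finsupp.single (T, α) 1)
        (ρ T j (a T α)) := by
  have h1 : ∀ α ∈ exponentsBelow n k, tensorCochain b θ (insert j T) p m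
      (truncMul f k j (Finsupp.single (T, α) 1)) (a (insert j T) α) =
      (tensorCochain b θ (insert j T) p m (Finsupp.single (T, α) 1) (ρ T j (a T α)) +
        if α j = 0 then 0 else tensorCochain b θ (insert j T) p m (Finsupp.single (T, α) 1)
          (a (insert j T) (α - Finsupp.single j 1))) -
      if α.degree + 1 < k then tensorCochain b θ (insert j T) p m
        (Finsupp.single (T, α + Finsupp.single j 1) 1) (a (insert j T) α) else 0 := by
    intro α hα
    rw [truncMul_single, map_sub, LinearMap.sub_apply, map_smul, LinearMap.smul_apply,
      ← map_smul, ha T j hj α (mem_exponentsBelow.1 hα), map_add]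
    congr 1
    · congr 1
      split_ifs
      · rw [map_zero]
      · rfl
    · split_ifs
      · rfl
      · rw [map_zero, LinearMap.zero_apply]
  rw [Finset.sum_congr rfl h1, Finset.sum_sub_distrib, Finset.sum_add_distrib,
    sum_exponentsBelow_shift j (fun α β => tensorCochain b θ (insert j T) p m
      (Finsupp.single (T, β) 1) (a (insert j T) α)), add_sub_cancel_right]

/-- Each pair (T, j) with j ∉ T contributes twice: through the Koszul differential of the summand at
T ∪ j and through the Čech differential of the summand at T. The two contributions cancel by the
recursion. -/
theorem d_sum_tensorCochain_eq_zero
    (hb : ∀ p i j hi hj x, (K.d i j).hom (b (p + 1) i hi x) = b p j hj (twistedBoundary f k x))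
    (hb0 : ∀ j x, (K.d 0 j).hom (b 0 0 rfl x) = 0)
    {ρ : ∀ S j, A S →ₗ[R] A (insert j S)}
    (hθ : ∀ i j, i + 1 = j → ∀ S s, (E.d i j).hom (θ i S s) =
      j.negOnePow • ∑ a ∈ Sᶜ, koszulSign R a (insert a S) • θ j (insert a S) (ρ S a s))
    {a : ∀ S, (Fin n →₀ ℕ) → A S}
    (ha : ∀ (S : Finset (Fin n)) (j : Fin n), j ∉ S → ∀ α : Fin n →₀ ℕ, α.degree < k →
      f j • a (insert j S) α =
        ρ S j (a S α) + if α j = 0 then 0 else a (insert j S) (α - Finsupp.single j 1)) :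
    ((tensorObj K E).d 0 1).hom (∑ S : Finset (Fin n), ∑ α ∈ exponentsBelow n k,
      tensorCochain b θ S S.card 0 (Finsupp.single (S, α) 1) (a S α)) = 0 := by
  have h1 : ∀ S : Finset (Fin n), ((tensorObj K E).d 0 1).hom (∑ α ∈ exponentsBelow n k,
      tensorCochain b θ S S.card 0 (Finsupp.single (S, α) 1) (a S α)) =
      ∑ j ∈ S, koszulSign R j S • ∑ α ∈ exponentsBelow n k, tensorCochain b θ S (S.erase j).card 1
          (truncMul f k j (Finsupp.single (S.erase j, α) 1)) (a S α) -
      ∑ j ∈ Sᶜ, koszulSign R j (insert j S) • ∑ α ∈ exponentsBelow n k,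
        tensorCochain b θ (insert j S) S.card 1 (Finsupp.single (S, α) 1) (ρ S j (a S α)) := by
    intro S
    rw [map_sum, Finset.sum_congr rfl fun α _ => d_tensorCochain_card hb hb0 hθ S α (a S α),
      Finset.sum_sub_distrib, Finset.sum_comm]
    congr 1
    · exact Finset.sum_congr rfl fun j _ => Finset.smul_sum.symm
    · rw [Finset.sum_comm]
      exact Finset.sum_congr rfl fun j _ => Finset.smul_sum.symm
  rw [map_sum, Finset.sum_congr rfl fun S _ => h1 S, Finset.sum_sub_distrib,
    sum_sum_mem_eq_sum_sum_insert (fun S j => koszulSign R j S • ∑ α ∈ exponentsBelow n k,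
      tensorCochain b θ S (S.erase j).card 1
        (truncMul f k j (Finsupp.single (S.erase j, α) 1)) (a S α)), sub_eq_zero]
  refine Finset.sum_congr rfl fun T _ => Finset.sum_congr rfl fun j hj => ?_
  have hj' := Finset.mem_compl.1 hj
  rw [Finset.erase_insert hj', sum_tensorCochain_truncMul ha hj']

/-- If `E` is such that `K ⊗ E` is acyclic, the image of the cycle of `d_sum_tensorCochain_eq_zero`
under `K ⊗ E ⟶ K ⊗ M` is a boundary. -/
theorem exists_d_eq_tensorElement {M : CochainComplex (ModuleCat.{u} R) ℤ}
    (hk : 1 ≤ k)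
    (hb : ∀ p i j hi hj x, (K.d i j).hom (b (p + 1) i hi x) = b p j hj (twistedBoundary f k x))
    (hb0 : ∀ j x, (K.d 0 j).hom (b 0 0 rfl x) = 0)
    {ρ : ∀ S j, A S →ₗ[R] A (insert j S)}
    (hθ : ∀ i j, i + 1 = j → ∀ S s, (E.d i j).hom (θ i S s) =
      j.negOnePow • ∑ a ∈ Sᶜ, koszulSign R a (insert a S) • θ j (insert a S) (ρ S a s))
    {a : ∀ S, (Fin n →₀ ℕ) → A S}
    (ha : ∀ (S : Finset (Fin n)) (j : Fin n), j ∉ S → ∀ α : Fin n →₀ ℕ, α.degree < k →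
      f j • a (insert j S) α =
        ρ S j (a S α) + if α j = 0 then 0 else a (insert j S) (α - Finsupp.single j 1))
    (ha0 : ∀ α ≠ 0, a ∅ α = 0) (hKE : (tensorObj K E).Acyclic) (φ : E ⟶ M)
    (hφ : ∀ i ≠ 0, ∀ S s, (φ.f i).hom (θ i S s) = 0) :
    ∃ y : (tensorObj K M).X (-1), ((tensorObj K M).d (-1) 0).hom y =
      tensorElement K M 0 0 0 (zero_add 0) (b 0 0 rfl (Finsupp.single (∅, 0) 1))
        ((φ.f 0).hom (θ 0 ∅ (a ∅ 0))) := by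
  have h1 := hKE 0
  rw [exactAt_iff' _ (-1) 0 1 (by simp) (by simp), ShortComplex.moduleCat_exact_iff] at h1
  obtain ⟨y, hy⟩ := h1 _ (d_sum_tensorCochain_eq_zero hb hb0 hθ ha)
  refine ⟨((tensorHom (𝟙 K) φ).f (-1)).hom y, ?_⟩
  have h2 := LinearMap.congr_fun (congrArg ModuleCat.Hom.hom ((tensorHom (𝟙 K) φ).comm (-1) 0)) y
  refine h2.trans ((congrArg ((tensorHom (𝟙 K) φ).f 0).hom hy).trans ?_)
  have h3 : ∀ (S : Finset (Fin n)) (α : Fin n →₀ ℕ), ((tensorHom (𝟙 K) φ).f 0).hom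
      (tensorCochain b θ S S.card 0 (Finsupp.single (S, α) 1) (a S α)) =
      tensorElement K M (-S.card) (0 + S.card) 0 (by omega)
        (b S.card (-S.card) rfl (Finsupp.single (S, α) 1))
          ((φ.f (0 + S.card)).hom (θ (0 + S.card) S (a S α))) :=
    fun S α => tensorHom_tensorElement φ _ _ _
  -- Only S = ∅ survives evaluation, and there only α = 0 has a nonzero coefficient.
  rw [map_sum, Finset.sum_eq_single ∅, map_sum, Finset.sum_eq_single 0]
  · exact h3 ∅ 0
  · intro α _ hα
    rw [h3, ha0 α hα, map_zero, map_zero, map_zero]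
  · intro h
    exact absurd (mem_exponentsBelow.2 (by simpa using Nat.pos_of_ne_zero (by omega))) h
  · intro S _ hS
    rw [map_sum]
    refine Finset.sum_eq_zero fun α _ => ?_
    rw [h3, hφ, map_zero]
    have := Finset.card_ne_zero.2 (Finset.nonempty_iff_ne_empty.2 hS)
    omega
  · intro h
    exact absurd (Finset.mem_univ _) h

end Cycle

/-! ### From boundaries to vanishing in homology. -/

section Homology

open CategoryTheory

variable {R : Type u} [CommRing R]

theorem singleObjHomologySelfIso_inv_comp_homologyMap_apply_eq_zero
    {L : CochainComplex (ModuleCat.{u} R) ℤ}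
    (Φ : HomologicalComplex.tensorUnit (ModuleCat.{u} R) (ComplexShape.up ℤ) ⟶ L) (h : R)
    (y : L.X (-1)) (hy : (L.d (-1) 0).hom y = (Φ.f 0).hom
      ((HomologicalComplex.singleObjXSelf (.up ℤ) 0 (ModuleCat.of R R)).inv.hom h)) :
    ((HomologicalComplex.singleObjHomologySelfIso (ComplexShape.up ℤ) 0 (ModuleCat.of R R)).inv ≫
      HomologicalComplex.homologyMap Φ 0).hom h = 0 := by
  have h1 : (HomologicalComplex.singleObjHomologySelfIso (ComplexShape.up ℤ) 0
      (ModuleCat.of R R)).inv ≫ HomologicalComplex.homologyMap Φ 0 =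
      ((HomologicalComplex.singleObjCyclesSelfIso (ComplexShape.up ℤ) 0 (ModuleCat.of R R)).inv ≫
        HomologicalComplex.cyclesMap Φ 0) ≫ L.homologyπ 0 := by
    rw [← HomologicalComplex.singleObjCyclesSelfIso_inv_homologyπ, Category.assoc, Category.assoc,
      HomologicalComplex.homologyπ_naturality]
  have h2 : ((HomologicalComplex.singleObjCyclesSelfIso (ComplexShape.up ℤ) 0
      (ModuleCat.of R R)).inv ≫ HomologicalComplex.cyclesMap Φ 0) ≫ L.iCycles 0 =
      (HomologicalComplex.singleObjXSelf (.up ℤ) 0 (ModuleCat.of R R)).inv ≫ Φ.f 0 := by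
    rw [Category.assoc, HomologicalComplex.cyclesMap_i]
    exact HomologicalComplex.singleObjCyclesSelfIso_inv_iCycles_assoc _ _ _ _
  have h3 : ((HomologicalComplex.singleObjCyclesSelfIso (ComplexShape.up ℤ) 0
      (ModuleCat.of R R)).inv ≫ HomologicalComplex.cyclesMap Φ 0).hom h =
        (L.toCycles (-1) 0).hom y := by
    apply (ModuleCat.mono_iff_injective (L.iCycles 0)).1 inferInstance
    have h4 := congrArg (fun g => g.hom h) h2
    have h5 := congrArg (fun g => g.hom y) (L.toCycles_i (-1) 0)
    exact h4.trans (hy.symm.trans h5.symm)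
  rw [h1, ModuleCat.hom_comp, LinearMap.comp_apply, h3]
  exact LinearMap.congr_fun (congrArg ModuleCat.Hom.hom (L.toCycles_comp_homologyπ (-1) 0)) y

/-- Lifting the unit to the resolution removes the inverse of the quasi-isomorphism, leaving a
genuine map of complexes on which elements can be followed. -/
theorem toDerivedTensorHomology_eq {K M : CochainComplex (ModuleCat.{u} R) ℤ}
    (η : HomologicalComplex.tensorUnit (ModuleCat.{u} R) (ComplexShape.up ℤ) ⟶ K)
    (ε : HomologicalComplex.tensorUnit (ModuleCat.{u} R) (ComplexShape.up ℤ) ⟶ M)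
    (P : KFlatResolution K)
    (v : HomologicalComplex.tensorUnit (ModuleCat.{u} R) (ComplexShape.up ℤ) ⟶ P.complex)
    (hv : HomologicalComplex.homologyMap (v ≫ P.hom) 0 = HomologicalComplex.homologyMap η 0) :
    toDerivedTensorHomology η ε P =
      (HomologicalComplex.singleObjHomologySelfIso (ComplexShape.up ℤ) 0 (ModuleCat.of R R)).inv ≫
        HomologicalComplex.homologyMap (v ≫ (HomologicalComplex.rightUnitor P.complex).inv ≫
          HomologicalComplex.tensorHom (𝟙 P.complex) ε) 0 := by
  rw [toDerivedTensorHomology, ← hv, HomologicalComplex.homologyMap_comp,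
    HomologicalComplex.homologyMap_comp, HomologicalComplex.homologyMap_comp, Category.assoc,
    isoOfQuasiIsoAt_hom_inv_id_assoc]

theorem unit_comp_rightUnitor_inv_apply {K M : CochainComplex (ModuleCat.{u} R) ℤ}
    (ε : HomologicalComplex.tensorUnit (ModuleCat.{u} R) (ComplexShape.up ℤ) ⟶ M)
    (v : HomologicalComplex.tensorUnit (ModuleCat.{u} R) (ComplexShape.up ℤ) ⟶ K) (h : R)
    (e : K.X 0) (hv : (v.f 0).hom
      ((HomologicalComplex.singleObjXSelf (.up ℤ) 0 (ModuleCat.of R R)).inv.hom h) = h • e) :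
    ((v ≫ (HomologicalComplex.rightUnitor K).inv ≫ HomologicalComplex.tensorHom (𝟙 K) ε).f 0).hom
      ((HomologicalComplex.singleObjXSelf (.up ℤ) 0 (ModuleCat.of R R)).inv.hom h) =
      tensorElement K M 0 0 0 (zero_add 0) e ((ε.f 0).hom
        ((HomologicalComplex.singleObjXSelf (.up ℤ) 0 (ModuleCat.of R R)).inv.hom h)) := by
  have h1 : ((HomologicalComplex.singleObjXSelf (.up ℤ) 0 (ModuleCat.of R R)).inv.hom h) =
      h • ((HomologicalComplex.singleObjXSelf (.up ℤ) 0 (ModuleCat.of R R)).inv.hom 1) := by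
    rw [← map_smul, smul_eq_mul, mul_one]
  change ((HomologicalComplex.tensorHom (𝟙 K) ε).f 0).hom
    (((HomologicalComplex.rightUnitor K).inv.f 0).hom ((v.f 0).hom _)) = _
  rw [hv, rightUnitor_inv_apply, tensorHom_tensorElement, map_smul, LinearMap.smul_apply,
    ← map_smul, ← map_smul, ← h1]

end Homology

/-! ### Conclusion. -/

section Main

open AlgebraicGeometry CategoryTheory

variable {R : Type u} [CommRing R] {n k : ℕ}

theorem toDerivedTensorHomology_apply_eq_zero (hn : 1 ≤ n) (hk : 1 ≤ k) (f : Fin n → R)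
    {J : Ideal R} (hJ : J = Ideal.span (Set.range f)) {Y : Scheme.{u}}
    {π : Y ⟶ Spec (CommRingCat.of R)} (g : Y ⟶ blowup (idealIntegralClosure (J ^ (n + k - 1))))
    (hg : g ≫ blowupMap (idealIntegralClosure (J ^ (n + k - 1))) = π)
    (I : InjectiveResolution (structureSheaf π))
    (P : KFlatResolution (buchsbaumEisenbud f k)) {h : R}
    (hh : h ∈ idealIntegralClosure (J ^ (n + k - 1))) :
    (toDerivedTensorHomology (buchsbaumEisenbudUnit f k) (derivedSectionsUnit π I) P).hom h = 0 := by
  obtain ⟨b, v, hb, hb0, hv, hv'⟩ := exists_twistedKoszul_lift f hk P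
  have hcoeff := exists_coefficients f hn hk hJ g hh
  rw [hg] at hcoeff
  obtain ⟨V, hV, a, ha1, ha0, ha⟩ := hcoeff
  obtain ⟨y, hy⟩ := exists_d_eq_tensorElement (f := f) (A := fun S => sectionsObj π (S.inf V))
    (b := b) (θ := coverCochain π V I) (ρ := restrictInsert π V) (a := a) hk hb hb0
    (fun i j hij S s => coverHomComplex_d_coverCochain π V I hij S s) ha ha0
    -- The only use of K-flatness, and of the fact that the V j cover Y.
    (P.kflat _ (coverHomComplex_acyclic hV I)) (coverEvaluation V I)
    (fun i hi S s => coverEvaluation_coverCochain_of_ne π V I hi S s)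
  rw [ha1, coverEvaluation_coverCochain_zero] at hy
  rw [toDerivedTensorHomology_eq _ _ P v hv]
  refine singleObjHomologySelfIso_inv_comp_homologyMap_apply_eq_zero _ h y (hy.trans ?_)
  refine (unit_comp_rightUnitor_inv_apply _ v h _ ?_).symm
  rw [hv', ← map_smul, Finsupp.smul_single, smul_eq_mul, mul_one]

end Main

end BrianconSkoda

theorem theorem2p2 {R : Type u} [CommRing R] {n k : ℕ} (hn : 1 ≤ n) (hk : 1 ≤ k) (f : Fin n → R)
    (J : Ideal R) (hJ : J = Ideal.span (Set.range f))
    (Y : AlgebraicGeometry.Scheme.{u})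
    (π : Y ⟶ AlgebraicGeometry.Spec (CommRingCat.of R))
    (g : Y ⟶ BrianconSkoda.blowup (BrianconSkoda.idealIntegralClosure (J ^ (n + k - 1))))
    (hg : CategoryTheory.CategoryStruct.comp g (BrianconSkoda.blowupMap
      (BrianconSkoda.idealIntegralClosure (J ^ (n + k - 1)))) = π)
    (I : CategoryTheory.InjectiveResolution (BrianconSkoda.structureSheaf π))
    (P : BrianconSkoda.KFlatResolution (BrianconSkoda.buchsbaumEisenbud f k)) :
    ∀ h ∈ BrianconSkoda.idealIntegralClosure (J ^ (n + k - 1)),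
      (BrianconSkoda.toDerivedTensorHomology (BrianconSkoda.buchsbaumEisenbudUnit f k)
        (BrianconSkoda.derivedSectionsUnit π I) P).hom h = 0 := by
  exact fun _ hh => BrianconSkoda.toDerivedTensorHomology_apply_eq_zero hn hk f hJ g hg I P hh
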